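/- **Setting.** Let $\kappa_0, S\ge 1$ be integers, put $a:=(\kappa_0+\tfrac14)\pi$, and let $a<E_1<E_2<\infty$. Fix $T>E_2/a$ and, for each $p=1,\dots,\kappa_0$, a sequence $(z_{p,m})_{m\in\mathbb N}$ in $(0,1)$ with $z_{p,m}\to p/(\kappa_0+\tfrac14)$ as $m\to\infty$; put $z_{-p,m}:=-z_{p,m}$. Let $$h_m(z):=\Big(\Big(\frac{\cosh z}{\cosh 1}\Big)^m+1\Big)^{-1},$$ and let $g_{m,S}$ be the even polynomial corrector $$g_{m,S}(z):=\sum_{j=\pm1,\dots,\pm\kappa_0}\ \sum_{k=1}^{S}a_{j,2k-1}\,f_{j,2k-1}(z),\qquad f_{j,2k-1}(z):=\frac{(z-z_{j,m})^{2k-1}}{(2k-1)!}\,\hat f_j(z),\qquad \hat f_j(z):=(z^2-T^2)^{2S}\prod_{j'\ne j}(z-z_{j',m})^{2S},$$ whose coefficients solve the triangular systems $\sum_{k\le n}a_{j,2k-1}f_{j,2k-1}^{(2n-1)}(z_{j,m})=-h_m^{(2n-1)}(z_{j,m})$, $n=1,\dots,S$ (for $m$ large, so that the nodes are distinct, the derivatives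 of orders $1,3,\dots,2S-1$ of $h_m+g_{m,S}$ then vanish at all the nodes). For $E\in[E_1,E_2]$ put $r:=a/E\in(0,1)$ and $$Q_m(E;y):=-E^2\big(h_m(y/r)+g_{m,S}(y/r)\big),\qquad y\in[-1,1].$$ Let $\mu_{1,m}(E)<\mu_{2,m}(E)<\cdots$ be the eigenvalues of $-\partial_y^2+Q_m(E;\cdot)$ on the even functions on $[-1,1]$ that vanish at $y=\pm1$. For $\ell\in\mathbb Z^{\kappa_0}$ let $\langle\ell\rangle:=\max\{1,|\ell|\}$, with the Euclidean norm. **Proposition.** There is $\bar m$ (depending on the data fixed above) such that the following holds for every $m\ge\bar m$. For all $E\in[E_1,E_2]$ the eigenvalues $\mu_{1,m}(E),\dots,\mu_{\kappa_0,m}(E)$ are negative, so that the frequency vector $$\vec\omega_m(E):=(\lambda_{1,m}(E),\dots,\lambda_{\kappa_0,m}(E)),\qquad \lambda_{j,m}(E):=\sqrt{-\mu_{j,m}(E)},$$ is well defined. Call an integer $m_0\ge1$ an *index of non-degeneracy* if there is $\rho_0>0$ with $$\max_{0\le n\le m_0}\big|\partial_E^n\,\vec\omega_m(E)\cdot\ell\big|\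 \ge\ \rho_0\langle\ell\rangle\qquad\text{for all }E\in[E_1,E_2],\ \ell\in\mathbb Z^{\kappa_0}\setminus\{0\},$$ and for $\bar\upsilon\in(0,1)$, $\bar\tau\in\mathbb R$ let $$\bar{\mathcal K}(\bar\upsilon,\bar\tau):=\big\{E\in[E_1,E_2]:\ |\vec\omega_m(E)\cdot\ell|\ge\bar\upsilon\,\langle\ell\rangle^{-\bar\tau}\ \text{ for all }\ell\in\mathbb Z^{\kappa_0}\setminus\{0\}\big\},$$ which is a Borel set. Then: 1. every sufficiently large integer $m_0$ is an index of non-degeneracy, and for every $\bar\tau\ge m_0\kappa_0$ $$\big|[E_1,E_2]\setminus\bar{\mathcal K}(\bar\upsilon,\bar\tau)\big|=o\big(\bar\upsilon^{1/m_0}\big)\qquad\text{as }\bar\upsilon\to0^+;$$ 2. for every index of non-degeneracy $m_0\ge1$ (the smallest one included) and every $\bar\tau\ge m_0\kappa_0$ there is a constant $C$, independent of $\bar\upsilon$, such that $$\big|[E_1,E_2]\setminus\bar{\mathcal K}(\bar\upsilon,\bar\tau)\big|\le C\,\bar\upsilon^{1/m_0}\qquad\text{for all }\bar\upsilon\in(0,1).$$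 -/

import Mathlib

open Filter Topology MeasureTheory Asymptotics

namespace ShearFlow

noncomputable section

/-! ### The analytic potential -/

/-- The product `E * r = (κ₀ + 1/4) * π` of the depth and the width of the well. -/
def wellConst (κ₀ : ℕ) : ℝ := ((κ₀ : ℝ) + 1 / 4) * Real.pi

/-- The regularised characteristic function of `(-1, 1)`,
`h_m(z) = ((cosh z / cosh 1) ^ m + 1)⁻¹`. -/
def stepFun (m : ℕ) (z : ℝ) : ℝ := ((Real.cosh z / Real.cosh 1) ^ m + 1)⁻¹

section Corrector

open Polynomial

variable {ι : Type*} [Fintype ι] [DecidableEq ι]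

/-- `f̂_j(z) = (z² - T²)^{2S} ∏_{i ≠ j} (z - ν_i)^{2S}`. -/
def hatPoly (S : ℕ) (T : ℝ) (ν : ι → ℝ) (j : ι) : ℝ[X] :=
  (X ^ 2 - C (T ^ 2)) ^ (2 * S) * ∏ i ∈ Finset.univ.erase j, (X - C (ν i)) ^ (2 * S)

/-- `f_{j,2k+1}(z) = (z - ν_j)^{2k+1} / (2k+1)! * f̂_j(z)`; the index `k` starts at `0`. -/
def oddPoly (S : ℕ) (T : ℝ) (ν : ι → ℝ) (j : ι) (k : ℕ) : ℝ[X] :=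
  C (((2 * k + 1).factorial : ℝ)⁻¹) * (X - C (ν j)) ^ (2 * k + 1) * hatPoly S T ν j

/-- The coefficients `a_{j,2k+1}`, obtained by solving the lower triangular linear system
`∑_{n ≤ k} a_{j,2n+1} f_{j,2n+1}^{(2k+1)}(ν_j) = - h_m^{(2k+1)}(ν_j)`, whose diagonal
entries are all equal to `f̂_j(ν_j)`. -/
def corrCoeff (m S : ℕ) (T : ℝ) (ν : ι → ℝ) (j : ι) (k : ℕ) : ℝ :=
  (-iteratedDeriv (2 * k + 1) (stepFun m) (ν j)
      - ∑ n : Fin k, corrCoeff m S T ν j n *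
          (derivative^[2 * k + 1] (oddPoly S T ν j n)).eval (ν j)) /
    (hatPoly S T ν j).eval (ν j)
termination_by k
decreasing_by exact n.2

/-- The polynomial `∑_j ∑_{k < S} a_{j,2k+1} f_{j,2k+1}` attached to a finite family of
points `ν`. -/
def corrPoly (m S : ℕ) (T : ℝ) (ν : ι → ℝ) : ℝ[X] :=
  ∑ j, ∑ k ∈ Finset.range S, C (corrCoeff m S T ν j k) * oddPoly S T ν j k

/-- The symmetric family `(± y_p)_p`. -/
def signed {κ₀ : ℕ} (y : Fin κ₀ → ℝ) : Fin κ₀ ⊕ Fin κ₀ → ℝ :=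
  Sum.elim y fun p => -y p

/-- The even polynomial corrector `g_{m,S}` with nodes `± y_p`: it makes the derivatives of
orders `1, 3, …, 2S - 1` of `h_m + g_{m,S}` vanish at all the nodes. -/
def corrector {κ₀ : ℕ} (m S : ℕ) (T : ℝ) (y : Fin κ₀ → ℝ) : ℝ[X] :=
  corrPoly m S T (signed y)

end Corrector

/-- The potential `Q_m(E; y) = -E² (h_m(y / r) + g_{m,S}(y / r))` with `r = (κ₀ + 1/4) π / E`.
The nodes `node p` are those of the rescaled variable `z = y / r`. -/
def potential {κ₀ : ℕ} (m S : ℕ) (T : ℝ) (node : Fin κ₀ → ℝ) (E y : ℝ) : ℝ :=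
  -E ^ 2 * (stepFun m (y / (wellConst κ₀ / E)) +
    (corrector m S T node).eval (y / (wellConst κ₀ / E)))

/-! ### The even Dirichlet spectrum of a Schrödinger operator on `[-1, 1]` -/

/-- `μ` is an eigenvalue of `-∂_y² + Q` on the even functions on `[-1, 1]` that vanish at `±1`:
there is a nonzero even `φ` with `φ(±1) = 0` and `φ'' = (Q - μ) φ` on `[-1, 1]`
(`φ'` is the derivative of `φ`; derivatives at `±1` are one-sided). For continuous `Q` these are
exactly the eigenvalues of the self-adjoint realisation in the even part of `L²`. -/
def IsEigenvalue (Q : ℝ → ℝ) (μ : ℝ) : Prop :=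
  ∃ φ φ' : ℝ → ℝ,
    (∀ y ∈ Set.Icc (-1 : ℝ) 1, HasDerivWithinAt φ (φ' y) (Set.Icc (-1) 1) y) ∧
    (∀ y ∈ Set.Icc (-1 : ℝ) 1, HasDerivWithinAt φ' ((Q y - μ) * φ y) (Set.Icc (-1) 1) y) ∧
    (∀ y ∈ Set.Icc (-1 : ℝ) 1, φ (-y) = φ y) ∧
    φ (-1) = 0 ∧ φ 1 = 0 ∧
    ∃ y ∈ Set.Icc (-1 : ℝ) 1, φ y ≠ 0

/-- `μ` is the eigenvalue number `j` (counted from `0`) in increasing order: exactly `j`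
eigenvalues lie strictly below it. All the eigenvalues are simple. -/
def IsNthEigenvalue (Q : ℝ → ℝ) (j : ℕ) (μ : ℝ) : Prop :=
  IsEigenvalue Q μ ∧ {ν : ℝ | IsEigenvalue Q ν ∧ ν < μ}.encard = j

/-- The eigenvalue number `j` (counted from `0`); there is at most one `μ` with
`IsNthEigenvalue Q j μ`. -/
def nthEigenvalue (Q : ℝ → ℝ) (j : ℕ) : ℝ := sInf {μ : ℝ | IsNthEigenvalue Q j μ}

/-- The frequency vector `ω_m(E) = (λ_{1,m}(E), …, λ_{κ₀,m}(E))`, where `-λ_{j,m}(E)²` is the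
`j`-th eigenvalue of `-∂_y² + Q_m(E; ·)`. -/
def freq {κ₀ : ℕ} (m S : ℕ) (T : ℝ) (node : Fin κ₀ → ℝ) (E : ℝ) (j : Fin κ₀) : ℝ :=
  Real.sqrt (-nthEigenvalue (potential m S T node E) j)

/-! ### Diophantine vectors and the index of non-degeneracy -/

/-- `⟨ℓ⟩ = max {1, |ℓ|}` with the Euclidean norm. -/
def bracket {d : ℕ} (ℓ : Fin d → ℤ) : ℝ := max 1 (Real.sqrt (∑ i, (ℓ i : ℝ) ^ 2))

/-- `w · ℓ`. -/
def pairing {d : ℕ} (w : Fin d → ℝ) (ℓ : Fin d → ℤ) : ℝ := ∑ i, w i * (ℓ i : ℝ)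

/-- `w` is `(υ, τ)`-Diophantine. -/
def IsDiophantine {d : ℕ} (υ τ : ℝ) (w : Fin d → ℝ) : Prop :=
  ∀ ℓ : Fin d → ℤ, ℓ ≠ 0 → υ * bracket ℓ ^ (-τ) ≤ |pairing w ℓ|

/-- The set of the `E ∈ [E₁, E₂]` at which the curve `w` is `(υ, τ)`-Diophantine. -/
def diophantineSet {d : ℕ} (w : ℝ → Fin d → ℝ) (E₁ E₂ υ τ : ℝ) : Set ℝ :=
  {E ∈ Set.Icc E₁ E₂ | IsDiophantine υ τ (w E)}

/-- `m₀` is an index of non-degeneracy of the curve `w` on `[E₁, E₂]`: for some `ρ₀ > 0`,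
`max_{0 ≤ n ≤ m₀} |∂_E^n (w(E) · ℓ)| ≥ ρ₀ ⟨ℓ⟩` for all `E ∈ [E₁, E₂]` and all integer vectors
`ℓ ≠ 0`. -/
def IsNondegIndex {d : ℕ} (w : ℝ → Fin d → ℝ) (E₁ E₂ : ℝ) (m₀ : ℕ) : Prop :=
  ∃ ρ₀ > 0, ∀ E ∈ Set.Icc E₁ E₂, ∀ ℓ : Fin d → ℤ, ℓ ≠ 0 →
    ∃ n ≤ m₀, ρ₀ * bracket ℓ ≤
      |iteratedDerivWithin n (fun E' => pairing (w E') ℓ) (Set.Icc E₁ E₂) E|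

end

end ShearFlow

namespace ShearFlow

noncomputable section

open scoped unitInterval

/-! ### The Volterra operator and the solutions of `ψ'' = -(W + ν) ψ` -/

/-! Write `a` for `wellConst κ₀` and put `L = E / a`, `z = L y`. Since `E² = a² L²`, the problem
becomes `-ψ'' - W ψ = ν ψ` on `[-L, L]` with `W = a² (h_m + g_{m,S})` independent of `E`: the depth
only moves the endpoint (`potential_eq`). Let `psi` be the solution with `ψ(0) = 1`, `ψ'(0) = 0`;
then `ν` is an eigenvalue iff `ψ(L, ν) = 0` (`isEigenvalue_iff`). Its Prüfer angle `θ` increases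
strictly with `ν` (`theta_lt_theta`) and crosses multiples of `π` only upwards in `L`
(`lt_theta_of_le`), so eigenvalue number `j` solves `θ(L, ν) = (j + 1) π`. For large `m`, `W` is
close to `a²` inside the well, `psi` at `ν = 0` is close to `cos (a z)`, and `θ(1, 0) > κ₀ π`
(`eventually_lt_theta_wellPotential`): there are `κ₀` negative eigenvalues for every `L > 1`.

The heart is that the frequencies `λ_j = L √(-ν_j(L))` satisfy no linear relation on any open
interval (`not_eventually_sum_branchFreq_eq_zero`). A relation continues analytically to smaller
`L`. Let `J` be its last index; follow it down to the length at which `ν_J` reaches `0`. There `λ_J`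
has a square-root singularity, because `ν_J' ≠ 0`, while all the deeper frequencies in the relation
are still analytic: a contradiction.

Hence at each `E` and each unit vector some derivative of `w · c` is nonzero, and compactness makes
the order and the bound uniform (`exists_isNondegIndex`). A function with a large `n`-th derivative
has small sublevel sets (`volume_sublevel_le`); summing over `ℓ` gives the `O(υ^{1/m₀})` bound
(`exists_volume_diophantineSet_compl_le`). The `o` bound for large `m₀` is the `O` bound for a
smaller index. -/

/-- A continuous function on `[0, 1]`, extended to the line by constants. -/
def lineExtend (f : C(I, ℝ)) : ℝ → ℝ := Set.IccExtend zero_le_one f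

theorem continuous_lineExtend (f : C(I, ℝ)) : Continuous (lineExtend f) :=
  f.continuous.Icc_extend'

theorem lineExtend_of_mem (f : C(I, ℝ)) {s : ℝ} (hs : s ∈ I) : lineExtend f s = f ⟨s, hs⟩ :=
  Set.IccExtend_of_mem zero_le_one f hs

theorem abs_lineExtend_le (f : C(I, ℝ)) (s : ℝ) : |lineExtend f s| ≤ ‖f‖ :=
  f.norm_coe_le_norm _

/-- The double primitive `f ↦ ∫₀ᵗ (t - s) f(s) ds`. -/
def volterra : C(I, ℝ) →L[ℝ] C(I, ℝ) :=
  LinearMap.mkContinuous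
    { toFun := fun f =>
        { toFun := fun t => ∫ s in (0 : ℝ)..t, ((t : ℝ) - s) * lineExtend f s
          continuous_toFun := by
            refine intervalIntegral.continuous_parametric_intervalIntegral_of_continuous
              (f := fun (t : I) s => ((t : ℝ) - s) * lineExtend f s) ?_ continuous_subtype_val
            have := continuous_lineExtend f
            fun_prop }
      map_add' := by
        intro f g
        ext t
        have hf := continuous_lineExtend f
        have hg := continuous_lineExtend g
        simp only [ContinuousMap.coe_mk, ContinuousMap.add_apply]
        rw [← intervalIntegral.integral_add]
        · congr 1
          ext s
          simp [lineExtend, Set.IccExtend, mul_add]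
        all_goals exact Continuous.intervalIntegrable (by fun_prop) _ _
      map_smul' := by
        intro c f
        ext t
        simp only [ContinuousMap.coe_mk, ContinuousMap.smul_apply, RingHom.id_apply, smul_eq_mul]
        rw [← intervalIntegral.integral_const_mul]
        congr 1
        ext s
        simp [lineExtend, Set.IccExtend]
        ring } 1 (by
      intro f
      refine (ContinuousMap.norm_le _ (by positivity)).2 fun t => ?_
      have ht := t.2
      have := intervalIntegral.norm_integral_le_of_norm_le_const (a := (0 : ℝ)) (b := t)
        (f := fun s => ((t : ℝ) - s) * lineExtend f s) (C := ‖f‖) (by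
          intro s hs
          rw [Set.uIoc_of_le ht.1] at hs
          rw [norm_mul]
          have h1 : ‖(t : ℝ) - s‖ ≤ 1 := by
            rw [Real.norm_eq_abs, abs_le]
            constructor <;> linarith [hs.1, hs.2, ht.1, ht.2]
          have h2 : ‖lineExtend f s‖ ≤ ‖f‖ := abs_lineExtend_le f s
          nlinarith [norm_nonneg (lineExtend f s), norm_nonneg ((t : ℝ) - s)])
      refine this.trans ?_
      have h3 : |(t : ℝ) - 0| ≤ 1 := by
        rw [abs_le]; constructor <;> linarith [ht.1, ht.2]
      nlinarith [norm_nonneg f])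

theorem volterra_apply (f : C(I, ℝ)) (t : I) :
    volterra f t = ∫ s in (0 : ℝ)..t, ((t : ℝ) - s) * lineExtend f s := rfl

/-- `u ↦ ∫₀ᵗ (t - s) q(s) u(s) ds`, as an operator depending linearly on `q`. -/
def volterraMul : C(I, ℝ) →L[ℝ] C(I, ℝ) →L[ℝ] C(I, ℝ) :=
  (ContinuousLinearMap.compL ℝ C(I, ℝ) C(I, ℝ) C(I, ℝ) volterra).comp
    (ContinuousLinearMap.mul ℝ C(I, ℝ))

theorem volterraMul_apply (q u : C(I, ℝ)) : volterraMul q u = volterra (q * u) := rfl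

/-- The kernel `t - s` is at most `1`, so each iteration integrates the previous bound once; the
iterated integrals produce the factorial that beats `‖q‖ ^ n` for any `q`. -/
theorem abs_volterraMul_pow_le (q u : C(I, ℝ)) (n : ℕ) (t : I) :
    |(volterraMul q ^ n) u t| ≤ ‖q‖ ^ n * ((t : ℝ) ^ n / n.factorial) * ‖u‖ := by
  induction n generalizing t with
  | zero => simpa using u.norm_coe_le_norm t
  | succ n ih =>
    rw [pow_succ', mul_apply_eq_comp, volterraMul_apply, volterra_apply]
    set v := (volterraMul q ^ n) u
    have ht := t.2
    have key := intervalIntegral.norm_integral_le_of_norm_le (a := (0 : ℝ)) (b := t) (μ := volume)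
      (f := fun s => ((t : ℝ) - s) * lineExtend (q * v) s)
      (g := fun s => ‖q‖ ^ (n + 1) * ‖u‖ / n.factorial * s ^ n) ht.1
      (Eventually.of_forall fun s hs => by
        have hs' : s ∈ I := ⟨hs.1.le, hs.2.trans ht.2⟩
        rw [lineExtend_of_mem _ hs', ContinuousMap.mul_apply, norm_mul, norm_mul]
        have h1 : ‖(t : ℝ) - s‖ ≤ 1 := by
          rw [Real.norm_eq_abs, abs_le]
          constructor <;> linarith [hs.1, hs.2, ht.1, ht.2]
        have h2 := q.norm_coe_le_norm ⟨s, hs'⟩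
        have h3 : ‖v ⟨s, hs'⟩‖ ≤ ‖q‖ ^ n * (s ^ n / n.factorial) * ‖u‖ := ih ⟨s, hs'⟩
        calc _ ≤ 1 * (‖q‖ * (‖q‖ ^ n * (s ^ n / n.factorial) * ‖u‖)) := by gcongr
          _ = _ := by ring)
      (Continuous.intervalIntegrable (by fun_prop) _ _)
    rw [Real.norm_eq_abs] at key
    refine key.trans (le_of_eq ?_)
    rw [intervalIntegral.integral_const_mul, integral_pow, Nat.factorial_succ]
    push_cast
    have : (n.factorial : ℝ) ≠ 0 := by positivity
    field_simp
    ring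

/-- Some power `V ^ n` has norm below `1`, so `1 - V ^ n` is invertible; `1 - V` divides it with a
commuting cofactor (the geometric sum), so it is invertible too. -/
theorem isUnit_one_sub_volterraMul (q : C(I, ℝ)) : IsUnit (1 - volterraMul q) := by
  obtain ⟨n, hn⟩ := ((FloorSemiring.tendsto_pow_div_factorial_atTop ‖q‖).eventually
    (gt_mem_nhds (zero_lt_one))).exists
  have hlt : ‖volterraMul q ^ n‖ < 1 := by
    refine lt_of_le_of_lt (ContinuousLinearMap.opNorm_le_bound _ (by positivity) fun u => ?_) hn
    refine (ContinuousMap.norm_le _ (by positivity)).2 fun t => ?_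
    refine (abs_volterraMul_pow_le q u n t).trans ?_
    have : (t : ℝ) ^ n ≤ 1 := pow_le_one₀ t.2.1 t.2.2
    calc _ ≤ ‖q‖ ^ n * (1 / n.factorial) * ‖u‖ := by gcongr
      _ = _ := by ring
  have hu : IsUnit (1 - volterraMul q ^ n) := by
    have h := isUnit_one_sub_of_norm_lt_one (R := C(I, ℝ) →L[ℝ] C(I, ℝ)) hlt
    exact h
  have h1 := mul_neg_geom_sum (volterraMul q) n
  have h2 := geom_sum_mul_neg (volterraMul q) n
  rw [← h1] at hu
  exact ((Commute.isUnit_mul_iff (show Commute _ _ from h1.trans h2.symm)).1 hu).1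

/-- The solution `u` of `u(t) = 1 + ∫₀ᵗ (t - s) q(s) u(s) ds`. -/
def volterraSol (q : C(I, ℝ)) : C(I, ℝ) := Ring.inverse (1 - volterraMul q) 1

/-- Inversion is analytic on the units of the Banach algebra of operators, and `q ↦ 1 - volterraMul
q` is affine. The analyticity of the eigenvalues in `E` comes from here. -/
theorem analyticAt_volterraSol (q : C(I, ℝ)) : AnalyticAt ℝ volterraSol q := by
  obtain ⟨w, hw⟩ := isUnit_one_sub_volterraMul q
  have h1 : AnalyticAt ℝ (fun q => 1 - volterraMul q) q := by
    have h : AnalyticAt ℝ volterraMul q := by apply ContinuousLinearMap.analyticAt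
    exact analyticAt_const.sub h
  have h2 : AnalyticAt ℝ Ring.inverse (1 - volterraMul q) := by
    rw [← hw]
    have h := analyticAt_inverse (𝕜 := ℝ) (A := C(I, ℝ) →L[ℝ] C(I, ℝ)) w
    exact h
  have h3 : AnalyticAt ℝ (fun q => Ring.inverse (1 - volterraMul q)) q :=
    AnalyticAt.comp (g := Ring.inverse) (f := fun q => 1 - volterraMul q) h2 h1
  exact ((ContinuousLinearMap.apply ℝ C(I, ℝ) (1 : C(I, ℝ))).analyticAt _).comp h3

theorem volterraSol_eq (q : C(I, ℝ)) :
    volterraSol q = 1 + volterra (q * volterraSol q) := by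
  have h := congrArg (fun T : C(I, ℝ) →L[ℝ] C(I, ℝ) => T 1)
    (Ring.mul_inverse_cancel _ (isUnit_one_sub_volterraMul q))
  simp only [mul_apply_eq_comp, _root_.sub_apply,
    one_apply_eq_self] at h
  rw [← volterraMul_apply]
  exact sub_eq_iff_eq_add.1 h

theorem eq_volterraSol {q u : C(I, ℝ)} (h : u = 1 + volterra (q * u)) : u = volterraSol q := by
  have h1 : (1 - volterraMul q) u = 1 := by
    simp only [_root_.sub_apply, one_apply_eq_self, volterraMul_apply]
    exact sub_eq_iff_eq_add.2 h
  rw [volterraSol, ← h1, ← mul_apply_eq_comp,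
    Ring.inverse_mul_cancel _ (isUnit_one_sub_volterraMul q), one_apply_eq_self]

/-- The function `s ↦ W(z s)` on `[0, 1]`. -/
def dilate (W : C(ℝ, ℝ)) (z : ℝ) : C(I, ℝ) := W.comp ⟨fun s : I => z * s, by fun_prop⟩

theorem dilate_apply (W : C(ℝ, ℝ)) (z : ℝ) (s : I) : dilate W z s = W (z * s) := rfl

/-- The coefficient of the equation `ψ'' = -(W + ν) ψ` on `[0, z]`, rescaled to `[0, 1]`. -/
def scaledCoeff (W : C(ℝ, ℝ)) (z ν : ℝ) : C(I, ℝ) :=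
  (-z ^ 2) • (dilate W z + ν • 1)

theorem scaledCoeff_apply (W : C(ℝ, ℝ)) (z ν : ℝ) (s : I) :
    scaledCoeff W z ν s = -z ^ 2 * (W (z * s) + ν) := by
  simp [scaledCoeff, dilate_apply]
  ring

/-- The solution of `ψ'' = -(W + ν) ψ`, `ψ(0) = 1`, `ψ'(0) = 0`. -/
def psi (W : C(ℝ, ℝ)) (z ν : ℝ) : ℝ := volterraSol (scaledCoeff W z ν) 1

/-- The analyticity of `W` enters only as `hW`, for the curve `z ↦ W(z ·)` in the sup norm. The
interval `[0, z]` is rescaled to `[0, 1]` so that `z` becomes a parameter of the coefficient. -/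
theorem analyticAt_psi {W : C(ℝ, ℝ)} (hW : ∀ z, AnalyticAt ℝ (dilate W) z) (p : ℝ × ℝ) :
    AnalyticAt ℝ (fun p : ℝ × ℝ => psi W p.1 p.2) p := by
  have h1 : AnalyticAt ℝ (fun p : ℝ × ℝ => scaledCoeff W p.1 p.2) p := by
    have h1 : AnalyticAt ℝ (fun p : ℝ × ℝ => dilate W p.1) p :=
      AnalyticAt.fun_comp (hW p.1) analyticAt_fst
    have h2 : AnalyticAt ℝ (fun p : ℝ × ℝ => p.2 • (1 : C(I, ℝ))) p :=
      analyticAt_snd.smul analyticAt_const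
    exact AnalyticAt.smul (f := fun p : ℝ × ℝ => -p.1 ^ 2) (analyticAt_fst.pow 2).neg (h1.add h2)
  have h2 : AnalyticAt ℝ (fun p : ℝ × ℝ => volterraSol (scaledCoeff W p.1 p.2)) p :=
    (analyticAt_volterraSol _).fun_comp h1
  exact ((ContinuousMap.evalCLM ℝ (1 : I)).analyticAt _).fun_comp h2

/-- Restricting the rescaled solution to `[0, t]` and stretching it back to `[0, 1]` solves the
integral equation for `z t`; uniqueness (`eq_volterraSol`) identifies the two. The endpoint values
`psi` thus form one solution of the differential equation. -/
theorem volterraSol_scaledCoeff (W : C(ℝ, ℝ)) (z ν : ℝ) (t : I) :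
    volterraSol (scaledCoeff W z ν) t = psi W (z * t) ν := by
  set u := volterraSol (scaledCoeff W z ν) with hu
  let v : C(I, ℝ) := u.comp ⟨fun s : I => t * s, by fun_prop⟩
  have hv : v = volterraSol (scaledCoeff W (z * t) ν) := by
    refine eq_volterraSol ?_
    ext s
    have h1 : v s = u (t * s) := rfl
    rw [h1, hu, volterraSol_eq, ← hu, ContinuousMap.add_apply, ContinuousMap.add_apply,
      volterra_apply, volterra_apply]
    congr 1
    have h2 : ((t * s : I) : ℝ) = t * s := rfl
    have h3 := intervalIntegral.mul_integral_comp_mul_left (a := (0 : ℝ)) (b := s)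
      (f := fun x => ((t * s : I) - x) * lineExtend (scaledCoeff W z ν * u) x) (t : ℝ)
    rw [mul_zero] at h3
    rw [h2] at h3 ⊢
    rw [← h3, ← intervalIntegral.integral_const_mul]
    refine intervalIntegral.integral_congr fun x hx => ?_
    rw [Set.uIcc_of_le s.2.1] at hx
    have hxI : x ∈ I := ⟨hx.1, hx.2.trans s.2.2⟩
    have htx : (t : ℝ) * x ∈ I := unitInterval.mul_mem t.2 hxI
    rw [lineExtend_of_mem _ hxI, lineExtend_of_mem _ htx]
    have h4 : v ⟨x, hxI⟩ = u ⟨t * x, htx⟩ := rfl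
    simp only [ContinuousMap.mul_apply, scaledCoeff_apply, h4]
    ring_nf
  have h1 : psi W (z * t) ν = v 1 := by rw [hv]; rfl
  rw [h1]
  change u t = u (t * 1)
  rw [mul_one]

theorem continuous_psi {W : C(ℝ, ℝ)} (hW : ∀ z, AnalyticAt ℝ (dilate W) z) :
    Continuous fun p : ℝ × ℝ => psi W p.1 p.2 :=
  continuous_iff_continuousAt.2 fun p => (analyticAt_psi hW p).continuousAt

theorem psi_eq_integral (W : C(ℝ, ℝ)) (z ν : ℝ) :
    psi W z ν = 1 + ∫ s in (0 : ℝ)..z, (z - s) * (-(W s + ν) * psi W s ν) := by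
  rw [psi, volterraSol_eq, ContinuousMap.add_apply, volterra_apply]
  congr 1
  rw [show ((1 : I) : ℝ) = 1 from rfl]
  have h := intervalIntegral.mul_integral_comp_mul_left (a := (0 : ℝ)) (b := 1)
      (f := fun x => (z - x) * (-(W x + ν) * psi W x ν)) z
  rw [mul_one, mul_zero] at h
  rw [← h, ← intervalIntegral.integral_const_mul]
  refine intervalIntegral.integral_congr fun x hx => ?_
  rw [Set.uIcc_of_le zero_le_one] at hx
  rw [lineExtend_of_mem _ hx, ContinuousMap.mul_apply, scaledCoeff_apply,
    volterraSol_scaledCoeff]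
  ring

/-- The derivative of `psi` with respect to the first variable. -/
def psiDeriv (W : C(ℝ, ℝ)) (z ν : ℝ) : ℝ := ∫ s in (0 : ℝ)..z, -(W s + ν) * psi W s ν

theorem continuous_psi_left {W : C(ℝ, ℝ)} (hW : ∀ z, AnalyticAt ℝ (dilate W) z) (ν : ℝ) :
    Continuous fun z => psi W z ν :=
  (continuous_psi hW).comp (f := fun z : ℝ => (z, ν)) (by fun_prop)

theorem hasDerivAt_psiDeriv {W : C(ℝ, ℝ)} (hW : ∀ z, AnalyticAt ℝ (dilate W) z) (z ν : ℝ) :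
    HasDerivAt (fun z => psiDeriv W z ν) (-(W z + ν) * psi W z ν) z := by
  have h := continuous_psi_left hW ν
  have hc : Continuous fun s => -(W s + ν) * psi W s ν := by fun_prop
  exact (hc.integral_hasStrictDerivAt 0 z).hasDerivAt

theorem hasDerivAt_psi {W : C(ℝ, ℝ)} (hW : ∀ z, AnalyticAt ℝ (dilate W) z) (z ν : ℝ) :
    HasDerivAt (fun z => psi W z ν) (psiDeriv W z ν) z := by
  have h := continuous_psi_left hW ν
  -- Splitting the kernel `z - s` leaves integrands that do not depend on `z`.
  have e : (fun z => psi W z ν) = fun z => 1 + (z * psiDeriv W z ν -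
      ∫ s in (0 : ℝ)..z, s * (-(W s + ν) * psi W s ν)) := by
    funext z
    rw [psi_eq_integral, psiDeriv, ← intervalIntegral.integral_const_mul,
      ← intervalIntegral.integral_sub]
    · congr 2
      funext s
      ring
    all_goals exact Continuous.intervalIntegrable (by fun_prop) _ _
  rw [e]
  have hc : Continuous fun s => s * (-(W s + ν) * psi W s ν) := by fun_prop
  have h1 := (hc.integral_hasStrictDerivAt 0 z).hasDerivAt
  have h2 := (((hasDerivAt_id z).mul (hasDerivAt_psiDeriv hW z ν)).sub h1).const_add 1
  exact h2.congr_deriv (by simp)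

theorem psi_zero (W : C(ℝ, ℝ)) (ν : ℝ) : psi W 0 ν = 1 := by
  rw [psi_eq_integral]; simp

theorem psiDeriv_zero (W : C(ℝ, ℝ)) (ν : ℝ) : psiDeriv W 0 ν = 0 := by
  simp [psiDeriv]

theorem continuous_psiDeriv {W : C(ℝ, ℝ)} (hW : ∀ z, AnalyticAt ℝ (dilate W) z) :
    Continuous fun p : ℝ × ℝ => psiDeriv W p.1 p.2 := by
  refine intervalIntegral.continuous_parametric_intervalIntegral_of_continuous
    (f := fun (p : ℝ × ℝ) s => -(W s + p.2) * psi W s p.2) ?_ continuous_fst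
  have : Continuous fun x : (ℝ × ℝ) × ℝ => psi W x.2 x.1.2 :=
    (continuous_psi hW).comp (f := fun x : (ℝ × ℝ) × ℝ => (x.2, x.1.2)) (by fun_prop)
  simp only [Function.uncurry_def]
  fun_prop

end

end ShearFlow

namespace ShearFlow

noncomputable section

/-! ### The Prüfer angle -/

/-- Grönwall: `N = ψ² + ψ'²` satisfies `|N'| ≤ |1 - (W + ν)| N` and `N(0) = 1`, so an exponential
weight makes it monotone on each side of `0`. -/
theorem psi_sq_add_psiDeriv_sq_pos {W : C(ℝ, ℝ)} (hW : ∀ z, AnalyticAt ℝ (dilate W) z) (z ν : ℝ) :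
    0 < psi W z ν ^ 2 + psiDeriv W z ν ^ 2 := by
  have hc : Continuous fun s => |1 - (W s + ν)| := by fun_prop
  set C : ℝ → ℝ := fun z => ∫ s in (0 : ℝ)..z, |1 - (W s + ν)| with hC
  have hC' : ∀ z, HasDerivAt C |1 - (W z + ν)| z := fun z =>
    (hc.integral_hasStrictDerivAt 0 z).hasDerivAt
  have hN : ∀ z, HasDerivAt (fun z => psi W z ν ^ 2 + psiDeriv W z ν ^ 2)
      (2 * psi W z ν * psiDeriv W z ν * (1 - (W z + ν))) z := fun z =>
    (((hasDerivAt_psi hW z ν).pow 2).add ((hasDerivAt_psiDeriv hW z ν).pow 2)).congr_deriv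
      (by push_cast; ring)
  have hb : ∀ z, |2 * psi W z ν * psiDeriv W z ν * (1 - (W z + ν))| ≤
      |1 - (W z + ν)| * (psi W z ν ^ 2 + psiDeriv W z ν ^ 2) := fun z => by
    rw [abs_mul, mul_comm]
    refine mul_le_mul_of_nonneg_left ?_ (abs_nonneg _)
    rw [abs_le]
    constructor <;> nlinarith [sq_nonneg (psi W z ν - psiDeriv W z ν),
      sq_nonneg (psi W z ν + psiDeriv W z ν)]
  have h0 : psi W 0 ν ^ 2 + psiDeriv W 0 ν ^ 2 = 1 := by simp [psi_zero, psiDeriv_zero]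
  have hC0 : C 0 = 0 := by simp [hC]
  rcases le_total 0 z with hz | hz
  · have hmono : Monotone fun z => (psi W z ν ^ 2 + psiDeriv W z ν ^ 2) * Real.exp (C z) := by
      refine monotone_of_hasDerivAt_nonneg (fun z => (hN z).mul (hC' z).exp) fun z => ?_
      have := (abs_le.1 (hb z)).1
      change 0 ≤ _ * _ + _ * (_ * _)
      nlinarith [Real.exp_pos (C z)]
    have h := hmono hz
    simp only [h0, hC0, Real.exp_zero, mul_one] at h
    by_contra! hneg
    nlinarith [Real.exp_pos (C z)]
  · have hmono : Antitone fun z => (psi W z ν ^ 2 + psiDeriv W z ν ^ 2) * Real.exp (-C z) := by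
      refine antitone_of_hasDerivAt_nonpos (fun z => (hN z).mul (hC' z).neg.exp) fun z => ?_
      have := (abs_le.1 (hb z)).2
      change _ * Real.exp (-C z) + _ * (Real.exp (-C z) * -_) ≤ 0
      nlinarith [Real.exp_pos (-C z)]
    have h := hmono hz
    simp only [h0, hC0, neg_zero, Real.exp_zero, mul_one] at h
    by_contra! hneg
    nlinarith [Real.exp_pos (-C z)]

/-- The Prüfer angle of `psi`: `ψ = ρ sin θ` and `ψ' = ρ cos θ` with `ρ > 0`. -/
def theta (W : C(ℝ, ℝ)) (z ν : ℝ) : ℝ :=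
  Real.pi / 2 + ∫ s in (0 : ℝ)..z, (psiDeriv W s ν ^ 2 + (W s + ν) * psi W s ν ^ 2) /
    (psi W s ν ^ 2 + psiDeriv W s ν ^ 2)

theorem theta_zero (W : C(ℝ, ℝ)) (ν : ℝ) : theta W 0 ν = Real.pi / 2 := by simp [theta]

theorem continuous_theta {W : C(ℝ, ℝ)} (hW : ∀ z, AnalyticAt ℝ (dilate W) z) :
    Continuous fun p : ℝ × ℝ => theta W p.1 p.2 := by
  refine continuous_const.add
    (intervalIntegral.continuous_parametric_intervalIntegral_of_continuous
    (f := fun (p : ℝ × ℝ) s => (psiDeriv W s p.2 ^ 2 + (W s + p.2) * psi W s p.2 ^ 2) /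
    (psi W s p.2 ^ 2 + psiDeriv W s p.2 ^ 2)) ?_ continuous_fst)
  have h1 : Continuous fun x : (ℝ × ℝ) × ℝ => psi W x.2 x.1.2 :=
    (continuous_psi hW).comp (f := fun x : (ℝ × ℝ) × ℝ => (x.2, x.1.2)) (by fun_prop)
  have h2 : Continuous fun x : (ℝ × ℝ) × ℝ => psiDeriv W x.2 x.1.2 :=
    (continuous_psiDeriv hW).comp (f := fun x : (ℝ × ℝ) × ℝ => (x.2, x.1.2)) (by fun_prop)
  simp only [Function.uncurry_def]
  exact Continuous.div (by fun_prop) (by fun_prop) fun x => (psi_sq_add_psiDeriv_sq_pos hW _ _).ne'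

theorem hasDerivAt_theta_aux {W : C(ℝ, ℝ)} (hW : ∀ z, AnalyticAt ℝ (dilate W) z) (z ν : ℝ) :
    HasDerivAt (fun z => theta W z ν) ((psiDeriv W z ν ^ 2 + (W z + ν) * psi W z ν ^ 2) /
      (psi W z ν ^ 2 + psiDeriv W z ν ^ 2)) z := by
  have h1 : Continuous fun z => psi W z ν := continuous_psi_left hW ν
  have h2 : Continuous fun z => psiDeriv W z ν :=
    continuous_iff_continuousAt.2 fun z => (hasDerivAt_psiDeriv hW z ν).continuousAt
  have hc : Continuous fun s => (psiDeriv W s ν ^ 2 + (W s + ν) * psi W s ν ^ 2) /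
      (psi W s ν ^ 2 + psiDeriv W s ν ^ 2) :=
    Continuous.div (by fun_prop) (by fun_prop) fun x => (psi_sq_add_psiDeriv_sq_pos hW _ _).ne'
  exact ((hc.integral_hasStrictDerivAt 0 z).hasDerivAt).const_add _

/-- Since `theta` is defined by an integral, its geometric meaning must be proved. `A = ψ cos θ - ψ'
sin θ` and `B = ψ sin θ + ψ' cos θ` both solve the linear equation `X' = c X`, with `A(0) = 0` and
`B(0) = 1`; so `A = 0`, and `B > 0` is the radius. -/
theorem exists_prufer_radius {W : C(ℝ, ℝ)} (hW : ∀ z, AnalyticAt ℝ (dilate W) z) (z ν : ℝ) :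
    ∃ ρ > 0, psi W z ν = ρ * Real.sin (theta W z ν) ∧
      psiDeriv W z ν = ρ * Real.cos (theta W z ν) := by
  have h1 : Continuous fun z => psi W z ν := continuous_psi_left hW ν
  have h2 : Continuous fun z => psiDeriv W z ν :=
    continuous_iff_continuousAt.2 fun z => (hasDerivAt_psiDeriv hW z ν).continuousAt
  set c : ℝ → ℝ := fun s => (psi W s ν * psiDeriv W s ν * (1 - (W s + ν))) /
      (psi W s ν ^ 2 + psiDeriv W s ν ^ 2) with hcdef
  have hc : Continuous c :=
    Continuous.div (by fun_prop) (by fun_prop) fun x => (psi_sq_add_psiDeriv_sq_pos hW _ _).ne'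
  set C : ℝ → ℝ := fun z => ∫ s in (0 : ℝ)..z, c s with hC
  have hC' : ∀ z, HasDerivAt C (c z) z := fun z => (hc.integral_hasStrictDerivAt 0 z).hasDerivAt
  have hC0 : C 0 = 0 := by simp [hC]
  have hA : ∀ z, HasDerivAt (fun z => (psi W z ν * Real.cos (theta W z ν) -
      psiDeriv W z ν * Real.sin (theta W z ν)) * Real.exp (-C z)) 0 z := fun z => by
    have hθ := hasDerivAt_theta_aux hW z ν
    refine ((((hasDerivAt_psi hW z ν).mul hθ.cos).sub ((hasDerivAt_psiDeriv hW z ν).mul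
      hθ.sin)).mul (hC' z).neg.exp).congr_deriv ?_
    simp only [Pi.sub_apply, Pi.mul_apply, Pi.neg_apply, hcdef]
    have := (psi_sq_add_psiDeriv_sq_pos hW z ν).ne'
    field_simp
    ring
  have hB : ∀ z, HasDerivAt (fun z => (psi W z ν * Real.sin (theta W z ν) +
      psiDeriv W z ν * Real.cos (theta W z ν)) * Real.exp (-C z)) 0 z := fun z => by
    have hθ := hasDerivAt_theta_aux hW z ν
    refine ((((hasDerivAt_psi hW z ν).mul hθ.sin).add ((hasDerivAt_psiDeriv hW z ν).mul
      hθ.cos)).mul (hC' z).neg.exp).congr_deriv ?_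
    simp only [Pi.add_apply, Pi.mul_apply, Pi.neg_apply, hcdef]
    have := (psi_sq_add_psiDeriv_sq_pos hW z ν).ne'
    field_simp
    ring
  have hA0 := is_const_of_deriv_eq_zero (fun z => (hA z).differentiableAt) (fun z => (hA z).deriv)
    z 0
  have hB0 := is_const_of_deriv_eq_zero (fun z => (hB z).differentiableAt) (fun z => (hB z).deriv)
    z 0
  simp only [psi_zero, psiDeriv_zero, theta_zero, hC0, neg_zero, Real.exp_zero,
    Real.cos_pi_div_two, Real.sin_pi_div_two, mul_zero, sub_zero, mul_one,
    add_zero] at hA0 hB0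
  have hE := Real.exp_pos (-C z)
  have hA1 := (mul_eq_zero.1 hA0).resolve_right hE.ne'
  set θ := theta W z ν
  refine ⟨psi W z ν * Real.sin θ + psiDeriv W z ν * Real.cos θ, ?_, ?_, ?_⟩
  · by_contra! h
    nlinarith
  · linear_combination (-psi W z ν) * Real.sin_sq_add_cos_sq θ + Real.cos θ * hA1
  · linear_combination (-psiDeriv W z ν) * Real.sin_sq_add_cos_sq θ - Real.sin θ * hA1

theorem hasDerivAt_theta {W : C(ℝ, ℝ)} (hW : ∀ z, AnalyticAt ℝ (dilate W) z) (z ν : ℝ) :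
    HasDerivAt (fun z => theta W z ν)
      (Real.cos (theta W z ν) ^ 2 + (W z + ν) * Real.sin (theta W z ν) ^ 2) z := by
  refine (hasDerivAt_theta_aux hW z ν).congr_deriv ?_
  obtain ⟨ρ, hρ, h1, h2⟩ := exists_prufer_radius hW z ν
  rw [h1, h2, div_eq_iff (by
    have := Real.sin_sq_add_cos_sq (theta W z ν)
    have h3 : (ρ * Real.sin (theta W z ν)) ^ 2 + (ρ * Real.cos (theta W z ν)) ^ 2 = ρ ^ 2 := by
      linear_combination ρ ^ 2 * this
    rw [h3]
    positivity)]
  linear_combination (-ρ ^ 2 * (Real.cos (theta W z ν) ^ 2 + (W z + ν) *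
    Real.sin (theta W z ν) ^ 2)) * Real.sin_sq_add_cos_sq (theta W z ν)

theorem psi_eq_zero_iff {W : C(ℝ, ℝ)} (hW : ∀ z, AnalyticAt ℝ (dilate W) z) (z ν : ℝ) :
    psi W z ν = 0 ↔ Real.sin (theta W z ν) = 0 := by
  obtain ⟨ρ, hρ, h1, -⟩ := exists_prufer_radius hW z ν
  rw [h1, mul_eq_zero, or_iff_right hρ.ne']

/-- A function that can cross the level `c` only upwards stays above `c`. -/
theorem lt_of_deriv_pos_of_eq {f f' : ℝ → ℝ} (hf : ∀ x, HasDerivAt f (f' x) x) {a b c : ℝ}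
    (hc : ∀ x, f x = c → 0 < f' x) (hab : a < b) (ha : c ≤ f a) : c < f b := by
  have hle : ∀ x ∈ Set.Icc a b, -f x ≤ -c :=
    image_le_of_deriv_right_lt_deriv_boundary (f := fun x => -f x) (f' := fun x => -f' x)
      (B := fun _ => -c) (B' := fun _ => 0)
      (fun x _ => (hf x).continuousAt.neg.continuousWithinAt)
      (fun x _ => (hf x).neg.hasDerivWithinAt) (neg_le_neg ha) (fun x => hasDerivAt_const _ _)
      (fun x _ hx => neg_lt_zero.2 (hc x (neg_inj.1 hx)))
  refine lt_of_le_of_ne (neg_le_neg_iff.1 (hle b ⟨hab.le, le_rfl⟩)) fun hb => ?_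
  -- If `f b = c`, the positive derivative at `b` puts `f` below `c` just to the left of `b`,
  -- against `hle`.
  have h1 := (hasDerivAt_iff_tendsto_slope.1 (hf b)).eventually (lt_mem_nhds (hc b hb.symm))
  have h2 : ∀ᶠ x in 𝓝[<] b, 0 < slope f b x := 
    h1.filter_mono (nhdsWithin_mono _ fun x hx => ne_of_lt hx)
  obtain ⟨x, hx, hxab⟩ := (h2.and (Ioo_mem_nhdsLT hab)).exists
  rw [slope_def_field, div_pos_iff] at hx
  have := hle x ⟨hxab.1.le, hxab.2.le⟩
  rcases hx with hx | hx <;> linarith [hx.1, hx.2, hxab.2]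

/-- At a multiple of `π` the term with `W + ν` drops out of the Prüfer equation and `θ' = cos² θ =
1`, whatever `W` is. -/
theorem lt_theta_of_le {W : C(ℝ, ℝ)} (hW : ∀ z, AnalyticAt ℝ (dilate W) z) {z z' ν : ℝ} (k : ℕ)
    (hz : z < z') (h : k * Real.pi ≤ theta W z ν) : k * Real.pi < theta W z' ν := by
  refine lt_of_deriv_pos_of_eq (fun x => hasDerivAt_theta hW x ν) (fun x hx => ?_) hz h
  rw [hx, Real.sin_nat_mul_pi]
  have := Real.sin_sq_add_cos_sq (k * Real.pi)
  rw [Real.sin_nat_mul_pi] at this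
  nlinarith

theorem theta_pos {W : C(ℝ, ℝ)} (hW : ∀ z, AnalyticAt ℝ (dilate W) z) {z : ℝ} (ν : ℝ)
    (hz : 0 ≤ z) : 0 < theta W z ν := by
  rcases hz.eq_or_lt with rfl | hz
  · rw [theta_zero]; positivity
  · simpa using lt_theta_of_le hW (ν := ν) 0 hz (by rw [theta_zero]; simp; positivity)

theorem psi_eq_zero_iff_exists {W : C(ℝ, ℝ)} (hW : ∀ z, AnalyticAt ℝ (dilate W) z) {z : ℝ} (ν : ℝ)
    (hz : 0 ≤ z) : psi W z ν = 0 ↔ ∃ k : ℕ, theta W z ν = (k + 1) * Real.pi := by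
  rw [psi_eq_zero_iff hW, Real.sin_eq_zero_iff]
  have hpos := theta_pos hW ν hz
  constructor
  · rintro ⟨n, hn⟩
    have hn0 : 0 < n := by
      rw [← hn] at hpos
      exact_mod_cast (pos_iff_pos_of_mul_pos hpos).2 Real.pi_pos
    refine ⟨(n - 1).toNat, ?_⟩
    rw [← hn]
    congr 1
    have : ((n - 1).toNat : ℤ) + 1 = n := by omega
    exact_mod_cast this.symm
  · rintro ⟨k, hk⟩
    exact ⟨k + 1, by rw [hk]; push_cast; ring⟩

/-- The level `π / 2` is a barrier, because `θ' = W + ν < 0` there. This bounds the spectrum from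
below. -/
theorem theta_le_pi_div_two {W : C(ℝ, ℝ)} (hW : ∀ z, AnalyticAt ℝ (dilate W) z) {L ν : ℝ}
    (hL : 0 ≤ L) (h : ∀ z ∈ Set.Icc 0 L, W z + ν < 0) : theta W L ν ≤ Real.pi / 2 := by
  refine image_le_of_deriv_right_lt_deriv_boundary (a := 0) (b := L)
      (f := fun z => theta W z ν) (f' := fun z => Real.cos (theta W z ν) ^ 2 + (W z + ν) *
        Real.sin (theta W z ν) ^ 2)
      (B := fun _ => Real.pi / 2) (B' := fun _ => 0)
      (fun x _ => (hasDerivAt_theta hW x ν).continuousAt.continuousWithinAt)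
      (fun x _ => (hasDerivAt_theta hW x ν).hasDerivWithinAt) (theta_zero W ν).le
      (fun x => hasDerivAt_const _ _) (fun x hx he => ?_) ⟨hL, le_rfl⟩
  rw [he, Real.cos_pi_div_two, Real.sin_pi_div_two]
  linarith [h x ⟨hx.1, hx.2.le⟩]

/-- The difference `D` of the two angles solves `D' = c D + (ν' - ν) sin² θ(·, ν')` with `D(0) = 0`,
so `D e^{-C}` is nondecreasing. It is not constant, because `θ` starts at `π / 2`, where the source
term is positive. -/
theorem theta_lt_theta {W : C(ℝ, ℝ)} (hW : ∀ z, AnalyticAt ℝ (dilate W) z) {L ν ν' : ℝ}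
    (hL : 0 < L) (h : ν < ν') : theta W L ν < theta W L ν' := by
  have hθ : ∀ ν, Continuous fun z => theta W z ν := fun ν =>
    continuous_iff_continuousAt.2 fun z => (hasDerivAt_theta hW z ν).continuousAt
  have h1 := hθ ν
  have h2 := hθ ν'
  set D : ℝ → ℝ := fun z => theta W z ν' - theta W z ν with hD
  -- `sin² x - sin² y = sin (x + y) sin (x - y)`; writing the last factor as `D sinc D` keeps the
  -- coefficient of `D` continuous where `D = 0`.
  set c : ℝ → ℝ := fun z => (W z + ν - 1) * (Real.sin (theta W z ν' + theta W z ν) *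
    Real.sinc (D z)) with hcdef
  have hc : Continuous c := by
    have := Real.continuous_sinc
    fun_prop
  set C : ℝ → ℝ := fun z => ∫ s in (0 : ℝ)..z, c s with hC
  have hC' : ∀ z, HasDerivAt C (c z) z := fun z => (hc.integral_hasStrictDerivAt 0 z).hasDerivAt
  have hderiv : ∀ z, HasDerivAt (fun z => D z * Real.exp (-C z))
      ((ν' - ν) * Real.sin (theta W z ν') ^ 2 * Real.exp (-C z)) z := fun z => by
    refine (((hasDerivAt_theta hW z ν').sub (hasDerivAt_theta hW z ν)).mul
      (hC' z).neg.exp).congr_deriv ?_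
    have hs : Real.sin (D z) = D z * Real.sinc (D z) := by
      by_cases h0 : D z = 0
      · simp [h0]
      · rw [Real.sinc_of_ne_zero h0]; field_simp
    have hsin : Real.sin (theta W z ν') ^ 2 - Real.sin (theta W z ν) ^ 2 =
        Real.sin (theta W z ν' + theta W z ν) * (D z * Real.sinc (D z)) := by
      rw [← hs, hD]
      simp only [Real.sin_add, Real.sin_sub]
      linear_combination Real.sin (theta W z ν) ^ 2 * Real.sin_sq_add_cos_sq (theta W z ν') -
        Real.sin (theta W z ν') ^ 2 * Real.sin_sq_add_cos_sq (theta W z ν)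
    have e1 := Real.sin_sq_add_cos_sq (theta W z ν)
    have e2 := Real.sin_sq_add_cos_sq (theta W z ν')
    simp only [Pi.sub_apply, Pi.neg_apply, hcdef]
    linear_combination (Real.exp (-C z)) * (e2 - e1 + (W z + ν - 1) * hsin)
  have hmono : Monotone fun z => D z * Real.exp (-C z) :=
    monotone_of_hasDerivAt_nonneg hderiv fun z => by
      have : 0 < ν' - ν := sub_pos.2 h
      change (0 : ℝ) ≤ _
      positivity
  have h0 : D 0 * Real.exp (-C 0) = 0 := by simp [hD, theta_zero]
  have hLpos : 0 < D L * Real.exp (-C L) := by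
    refine lt_of_le_of_ne (h0 ▸ hmono hL.le) fun hzero => ?_
    have hconst : ∀ z ∈ Set.Ioo 0 L, D z * Real.exp (-C z) = 0 := fun z hz =>
      le_antisymm (hzero ▸ hmono hz.2.le) (h0 ▸ hmono hz.1.le)
    have hz : ∀ z ∈ Set.Ioo 0 L, Real.sin (theta W z ν') ^ 2 = 0 := fun z hz => by
      have e : (fun z => D z * Real.exp (-C z)) =ᶠ[𝓝 z] fun _ => 0 := by
        filter_upwards [Ioo_mem_nhds hz.1 hz.2] with y hy using hconst y hy
      have := (hderiv z).unique ((hasDerivAt_const z (0 : ℝ)).congr_of_eventuallyEq e)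
      have h3 : 0 < ν' - ν := sub_pos.2 h
      simpa [h3.ne', (Real.exp_pos _).ne'] using this
    have hlim : Tendsto (fun z => Real.sin (theta W z ν') ^ 2) (𝓝[>] 0) (𝓝 1) := by
      have : Tendsto (fun z => Real.sin (theta W z ν') ^ 2) (𝓝 0)
          (𝓝 (Real.sin (theta W 0 ν') ^ 2)) := Continuous.tendsto (by fun_prop) 0
      rw [theta_zero, Real.sin_pi_div_two, one_pow] at this
      exact this.mono_left nhdsWithin_le_nhds
    have := tendsto_nhds_unique (hlim.congr' (by
      filter_upwards [Ioo_mem_nhdsGT hL] with z hz' using hz z hz')) tendsto_const_nhds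
    norm_num at this
  exact sub_pos.1 (pos_of_mul_pos_left hLpos (Real.exp_pos _).le)

end

end ShearFlow

namespace ShearFlow

noncomputable section

open scoped ContDiff

/-! ### Simplicity of the eigenvalues and their analytic branches -/

theorem lagrange_identity {W : C(ℝ, ℝ)} (hW : ∀ z, AnalyticAt ℝ (dilate W) z) (L ν ν' : ℝ) :
    psi W L ν * psiDeriv W L ν' - psiDeriv W L ν * psi W L ν' =
      (ν - ν') * ∫ s in (0 : ℝ)..L, psi W s ν * psi W s ν' := by
  have h1 := continuous_psi_left hW ν
  have h2 := continuous_psi_left hW ν'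
  have hd : ∀ z, HasDerivAt
      (fun z => psi W z ν * psiDeriv W z ν' - psiDeriv W z ν * psi W z ν')
      ((ν - ν') * (psi W z ν * psi W z ν')) z := fun z =>
    (((hasDerivAt_psi hW z ν).mul (hasDerivAt_psiDeriv hW z ν')).sub
      ((hasDerivAt_psiDeriv hW z ν).mul (hasDerivAt_psi hW z ν'))).congr_deriv (by ring)
  have := intervalIntegral.integral_eq_sub_of_hasDerivAt (a := 0) (b := L) (fun z _ => hd z)
    (Continuous.intervalIntegrable (by fun_prop) _ _)
  rw [intervalIntegral.integral_const_mul] at this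
  rw [this]
  simp [psiDeriv_zero]

theorem psiDeriv_ne_zero {W : C(ℝ, ℝ)} (hW : ∀ z, AnalyticAt ℝ (dilate W) z) {L ν : ℝ}
    (h : psi W L ν = 0) : psiDeriv W L ν ≠ 0 := fun h' => by
  have := psi_sq_add_psiDeriv_sq_pos hW L ν
  rw [h, h'] at this
  norm_num at this

theorem fderiv_psi_inl {W : C(ℝ, ℝ)} (hW : ∀ z, AnalyticAt ℝ (dilate W) z) (L ν : ℝ) :
    fderiv ℝ (fun p : ℝ × ℝ => psi W p.1 p.2) (L, ν) (1, 0) = psiDeriv W L ν := by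
  have h1 : HasFDerivAt (fun p : ℝ × ℝ => psi W p.1 p.2) _ ((fun z : ℝ => (z, ν)) L) :=
    (analyticAt_psi hW (L, ν)).differentiableAt.hasFDerivAt
  have h2 : HasDerivAt (fun z : ℝ => (z, ν)) (1, 0) L :=
    (hasDerivAt_id L).prodMk (hasDerivAt_const L ν)
  have h3 := h1.comp_hasDerivAt L h2
  exact h3.unique (hasDerivAt_psi hW L ν)

/-- Dividing the Lagrange identity by the difference of the two spectral parameters and letting it
tend to `0` gives `ψ'(L) ∂_ν ψ(L) = ∫ ψ² > 0` at a zero of `ψ`. -/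
theorem fderiv_psi_inr_ne_zero {W : C(ℝ, ℝ)} (hW : ∀ z, AnalyticAt ℝ (dilate W) z) {L ν : ℝ}
    (hL : 0 < L) (h : psi W L ν = 0) :
    fderiv ℝ (fun p : ℝ × ℝ => psi W p.1 p.2) (L, ν) (0, 1) ≠ 0 := by
  have h1 : HasFDerivAt (fun p : ℝ × ℝ => psi W p.1 p.2) _ ((fun y : ℝ => (L, y)) ν) :=
    (analyticAt_psi hW (L, ν)).differentiableAt.hasFDerivAt
  have h2 : HasDerivAt (fun y : ℝ => (L, y)) (0, 1) ν :=
    (hasDerivAt_const ν L).prodMk (hasDerivAt_id ν)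
  have h3 : HasDerivAt (fun y => psi W L y) _ ν := h1.comp_hasDerivAt ν h2
  have hc1 := continuous_psi_left hW ν
  have hcont : Continuous fun y => ∫ s in (0 : ℝ)..L, psi W s ν * psi W s y := by
    refine intervalIntegral.continuous_parametric_intervalIntegral_of_continuous'
      (f := fun y s => psi W s ν * psi W s y) ?_ _ _
    have : Continuous fun x : ℝ × ℝ => psi W x.2 x.1 :=
      (continuous_psi hW).comp (f := fun x : ℝ × ℝ => (x.2, x.1)) (by fun_prop)
    simp only [Function.uncurry_def]
    fun_prop
  have h4 : HasDerivAt (fun y => psiDeriv W L ν * psi W L y)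
      (∫ s in (0 : ℝ)..L, psi W s ν * psi W s ν) ν := by
    rw [hasDerivAt_iff_tendsto_slope]
    refine (hcont.tendsto ν |>.mono_left nhdsWithin_le_nhds).congr' ?_
    filter_upwards [self_mem_nhdsWithin] with y hy
    have hy' : y - ν ≠ 0 := sub_ne_zero.2 hy
    have := lagrange_identity hW L ν y
    rw [slope_def_field, eq_div_iff hy', h]
    rw [h] at this
    linear_combination this
  have h5 := (h3.const_mul (psiDeriv W L ν)).unique h4
  intro h0
  rw [h0, mul_zero] at h5
  have hpos : 0 < ∫ s in (0 : ℝ)..L, psi W s ν * psi W s ν := by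
    refine intervalIntegral.integral_pos hL (Continuous.continuousOn (by fun_prop))
      (fun x _ => mul_self_nonneg _) ⟨0, ⟨le_rfl, hL.le⟩, ?_⟩
    rw [psi_zero]; norm_num
  exact hpos.ne h5

/-- Implicit function theorem, with `∂_ν ψ ≠ 0`. A critical point of the branch would force `∂_L ψ =
ψ' = 0` at a zero of `ψ`, which is impossible. The nonzero slope is what later produces a genuine
square-root singularity. -/
theorem exists_analytic_branch {W : C(ℝ, ℝ)} (hW : ∀ z, AnalyticAt ℝ (dilate W) z) {L ν : ℝ}
    (hL : 0 < L) (h : psi W L ν = 0) :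
    ∃ n : ℝ → ℝ, AnalyticAt ℝ n L ∧ n L = ν ∧ (∀ᶠ z in 𝓝 L, psi W z (n z) = 0) ∧
      deriv n L ≠ 0 := by
  set F : ℝ × ℝ → ℝ := fun p => psi W p.1 p.2 with hF
  have hFa : AnalyticAt ℝ F (L, ν) := analyticAt_psi hW (L, ν)
  have cdf : ContDiffAt ℝ ω F (L, ν) := hFa.contDiffAt
  have hne := fderiv_psi_inr_ne_zero hW hL h
  have hinv : (fderiv ℝ F (L, ν) ∘L .inr ℝ ℝ ℝ).IsInvertible := by
    refine ⟨ContinuousLinearEquiv.unitsEquivAut ℝ (Units.mk0 _ hne), ?_⟩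
    ext
    simp [hF]
  have hn0 : cdf.implicitFunction (by simp) hinv L = ν := cdf.implicitFunction_apply_self (by simp) hinv
  have hna := cdf.contDiffAt_implicitFunction (by simp) hinv
  have hnz := cdf.eventually_apply_implicitFunction (by simp) hinv
  set n := cdf.implicitFunction (by simp) hinv
  refine ⟨n, ContDiffAt.analyticAt hna, hn0, ?_, ?_⟩
  · filter_upwards [hnz] with z hz
    simpa [hF, h] using hz
  · intro hd
    have hnd : HasDerivAt n 0 L := hd ▸ (hna.differentiableAt (by simp)).hasDerivAt
    have h1 : HasFDerivAt F (fderiv ℝ F (L, ν)) ((fun z : ℝ => (z, n z)) L) := by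
      simp only [hn0]
      exact hFa.differentiableAt.hasFDerivAt
    have h2 : HasDerivAt (fun z : ℝ => (z, n z)) (1, 0) L := (hasDerivAt_id L).prodMk hnd
    have h3 := h1.comp_hasDerivAt L h2
    rw [fderiv_psi_inl hW] at h3
    have h4 : HasDerivAt (F ∘ fun z : ℝ => (z, n z)) 0 L :=
      (hasDerivAt_const L (F (L, ν))).congr_of_eventuallyEq hnz
    exact psiDeriv_ne_zero hW h (h3.unique h4)

theorem theta_injective {W : C(ℝ, ℝ)} (hW : ∀ z, AnalyticAt ℝ (dilate W) z) {L : ℝ}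
    (hL : 0 < L) : Function.Injective (theta W L) :=
  (show StrictMono (theta W L) from fun _ _ h => theta_lt_theta hW hL h).injective

open Classical in
/-- The eigenvalue number `j` (counted from `0`) of the even Dirichlet problem on `[-L, L]`. -/
def eigBranch (W : C(ℝ, ℝ)) (j : ℕ) (L : ℝ) : ℝ :=
  -- The default `0` plays no role, since every use first shows that a solution exists, and
  -- injectivity of `θ` in `ν` makes the choice immaterial.
  if h : ∃ ν, theta W L ν = (j + 1) * Real.pi then h.choose else 0

theorem eigBranch_eq {W : C(ℝ, ℝ)} (hW : ∀ z, AnalyticAt ℝ (dilate W) z) {j : ℕ} {L ν : ℝ}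
    (hL : 0 < L) (h : theta W L ν = (j + 1) * Real.pi) : eigBranch W j L = ν := by
  have h' : ∃ ν, theta W L ν = (j + 1) * Real.pi := ⟨ν, h⟩
  rw [eigBranch, dif_pos h']
  exact theta_injective hW hL (h'.choose_spec.trans h.symm)

/-- Along the implicit branch `θ` is a multiple of `π`, and by continuity it stays the same
multiple, so the branch keeps its number `j`. -/
theorem analyticAt_eigBranch {W : C(ℝ, ℝ)} (hW : ∀ z, AnalyticAt ℝ (dilate W) z) {j : ℕ}
    {L ν : ℝ} (hL : 0 < L) (h : theta W L ν = (j + 1) * Real.pi) :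
    AnalyticAt ℝ (eigBranch W j) L ∧ deriv (eigBranch W j) L ≠ 0 := by
  have h0 : psi W L ν = 0 := (psi_eq_zero_iff_exists hW ν hL.le).2 ⟨j, h⟩
  obtain ⟨n, hna, hn0, hnz, hnd⟩ := exists_analytic_branch hW hL h0
  have hcont : Tendsto (fun z => theta W z (n z)) (𝓝 L) (𝓝 ((j + 1) * Real.pi)) := by
    have h1 : Tendsto (fun z => (z, n z)) (𝓝 L) (𝓝 (L, n L)) :=
      (continuousAt_id.prodMk hna.continuousAt)
    have := ((continuous_theta hW).tendsto (L, n L)).comp h1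
    rwa [hn0, h] at this
  have hev : eigBranch W j =ᶠ[𝓝 L] n := by
    filter_upwards [hnz, lt_mem_nhds hL, hcont.eventually (Metric.ball_mem_nhds _ Real.pi_pos)]
      with z hz hz0 hzb
    refine eigBranch_eq hW hz0 ?_
    obtain ⟨k, hk⟩ := (psi_eq_zero_iff_exists hW _ hz0.le).1 hz
    rw [hk, Real.dist_eq, ← sub_mul, abs_mul, abs_of_pos Real.pi_pos] at hzb
    have h1 : |((k : ℝ) + 1) - (j + 1)| < 1 := by
      by_contra! h2
      nlinarith [Real.pi_pos]
    have h2 : k = j := by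
      rw [abs_lt] at h1
      have h3 : (k : ℝ) < j + 1 := by linarith
      have h4 : (j : ℝ) < k + 1 := by linarith
      have h3' : k < j + 1 := by exact_mod_cast h3
      have h4' : j < k + 1 := by exact_mod_cast h4
      omega
    rw [hk, h2]
  exact ⟨hna.congr hev.symm, by rwa [hev.deriv_eq]⟩

theorem exists_theta_eq {W : C(ℝ, ℝ)} (hW : ∀ z, AnalyticAt ℝ (dilate W) z) {L ν₀ : ℝ} (j : ℕ)
    (hL : 0 < L) (h : (j + 1) * Real.pi ≤ theta W L ν₀) :
    ∃ ν, theta W L ν = (j + 1) * Real.pi := by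
  obtain ⟨B, hB⟩ := isCompact_Icc.bddAbove_image (W.continuous.continuousOn (s := Set.Icc 0 L))
  have h1 : theta W L (-B - 1) ≤ Real.pi / 2 := theta_le_pi_div_two hW hL.le fun z hz => by
    linarith [hB (Set.mem_image_of_mem W hz)]
  have hc : Continuous (theta W L) :=
    (continuous_theta hW).comp (f := fun ν : ℝ => (L, ν)) (by fun_prop)
  refine mem_range_of_exists_le_of_exists_ge hc ⟨_, h1.trans ?_⟩ ⟨ν₀, h⟩
  nlinarith [Real.pi_pos, (Nat.cast_nonneg j : (0 : ℝ) ≤ j)]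

theorem theta_eigBranch {W : C(ℝ, ℝ)} (hW : ∀ z, AnalyticAt ℝ (dilate W) z) {L : ℝ} {j : ℕ}
    (hL : 0 < L) (h : (j + 1) * Real.pi < theta W L 0) :
    theta W L (eigBranch W j L) = (j + 1) * Real.pi ∧ eigBranch W j L < 0 := by
  obtain ⟨ν, hν⟩ := exists_theta_eq hW j hL h.le
  rw [eigBranch_eq hW hL hν]
  refine ⟨hν, ?_⟩
  rw [← hν] at h
  exact (show StrictMono (theta W L) from fun _ _ h => theta_lt_theta hW hL h).lt_iff_lt.1 h

/-! ### Linear independence of the frequencies -/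

/-- The frequency number `j`, as a function of `L`. -/
def branchFreq (W : C(ℝ, ℝ)) (j : ℕ) (L : ℝ) : ℝ := L * √(-eigBranch W j L)

theorem analyticAt_branchFreq {W : C(ℝ, ℝ)} (hW : ∀ z, AnalyticAt ℝ (dilate W) z) {L : ℝ} {j : ℕ}
    (hL : 0 < L) (h : (j + 1) * Real.pi < theta W L 0) : AnalyticAt ℝ (branchFreq W j) L := by
  obtain ⟨h1, h2⟩ := theta_eigBranch hW hL h
  have h3 := (analyticAt_eigBranch hW hL h1).1
  have h4 : AnalyticAt ℝ (fun x : ℝ => √x) (-eigBranch W j L) :=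
    ContDiffAt.analyticAt (Real.contDiffAt_sqrt (by linarith))
  exact analyticAt_id.mul (AnalyticAt.fun_comp h4 h3.neg)

/-- A frequency loses analyticity where its eigenvalue reaches `0`, and frequencies with different
indices do so at different lengths, the last index at the largest one. Continuing a relation down to
that length isolates one singular term. -/
theorem not_eventually_sum_branchFreq_eq_zero {W : C(ℝ, ℝ)}
    (hW : ∀ z, AnalyticAt ℝ (dilate W) z) {N : ℕ} {L₀ x : ℝ} (hL₀ : 0 < L₀) (hx : L₀ ≤ x)
    (hN : N * Real.pi < theta W L₀ 0) {c : Fin N → ℝ} (hc : c ≠ 0) :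
    ¬ ∀ᶠ L in 𝓝 x, ∑ j, c j * branchFreq W j L = 0 := by
  intro hzero
  have hne : (Finset.univ.filter fun j => c j ≠ 0).Nonempty := by
    obtain ⟨j, hj⟩ := Function.ne_iff.1 hc
    exact ⟨j, by simpa using hj⟩
  obtain ⟨J, hJ, hmax⟩ := Finset.exists_maximal hne
  have hcJ : c J ≠ 0 := by simpa using hJ
  have hcgt : ∀ i, J < i → c i = 0 := fun i hi => by
    by_contra h
    exact (lt_irrefl _ (hi.trans_le (hmax (by simpa using h) hi.le)))
  have hθc : Continuous fun z => theta W z 0 :=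
    continuous_iff_continuousAt.2 fun z => (hasDerivAt_theta hW z 0).continuousAt
  have hJN : ((J : ℕ) + 1 : ℝ) ≤ N := by exact_mod_cast J.2
  -- `Ls` is the length at which eigenvalue number `J` equals `0`. It exists because `θ(·, 0)` goes
  -- from `π / 2` at `0` to a value above `N π` at `L₀`.
  obtain ⟨Ls, hLs, hθ⟩ : (((J : ℕ) : ℝ) + 1) * Real.pi ∈ (fun z => theta W z 0) '' Set.Icc 0 L₀ := by
    refine intermediate_value_Icc hL₀.le hθc.continuousOn ⟨?_, ?_⟩
    · simp only [theta_zero]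
      nlinarith [Real.pi_pos, (Nat.cast_nonneg (J : ℕ) : (0 : ℝ) ≤ (J : ℕ))]
    · exact (mul_le_mul_of_nonneg_right hJN Real.pi_pos.le).trans hN.le
  simp only at hθ
  have hLs0 : 0 < Ls := by
    refine lt_of_le_of_ne hLs.1 fun h => ?_
    rw [← h, theta_zero] at hθ
    nlinarith [Real.pi_pos, (Nat.cast_nonneg (J : ℕ) : (0 : ℝ) ≤ (J : ℕ))]
  have hLsx : Ls < x := by
    refine lt_of_lt_of_le (lt_of_le_of_ne hLs.2 fun h => ?_) hx
    rw [h] at hθ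
    rw [hθ] at hN
    exact absurd (mul_le_mul_of_nonneg_right hJN Real.pi_pos.le) (not_le.2 hN)
  set f : ℝ → ℝ := fun L => ∑ j ∈ Finset.univ.filter (· < J), c j * branchFreq W j L with hf
  have hsum : ∀ L, ∑ j, c j * branchFreq W j L = f L + c J * branchFreq W J L := fun L => by
    rw [← Finset.sum_filter_add_sum_filter_not Finset.univ (· < J)]
    congr 1
    refine Finset.sum_eq_single_of_mem J (by simp) fun i hi hiJ => ?_
    have : J < i := lt_of_le_of_ne (by simpa using hi) hiJ.symm
    rw [hcgt i this, zero_mul]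
  have hfan : ∀ L, Ls ≤ L → AnalyticAt ℝ f L := fun L hL => by
    refine Finset.analyticAt_fun_sum _ fun i hi => analyticAt_const.mul ?_
    refine analyticAt_branchFreq hW (hLs0.trans_le hL) ?_
    have hi : i < J := by simpa using hi
    have hiJ : ((i : ℕ) + 1 : ℝ) < (J : ℕ) + 1 := by
      have : ((i : ℕ) : ℝ) < (J : ℕ) := by exact_mod_cast hi
      linarith
    have h1 : ((i : ℕ) + 1 : ℝ) * Real.pi < theta W Ls 0 := by
      rw [hθ]; exact mul_lt_mul_of_pos_right hiJ Real.pi_pos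
    rcases hL.eq_or_lt with rfl | hL
    · exact h1
    · exact_mod_cast lt_theta_of_le hW ((i : ℕ) + 1) hL (by exact_mod_cast h1.le)
  have hJan : ∀ L, Ls < L → AnalyticAt ℝ (branchFreq W J) L ∧ eigBranch W J L < 0 := fun L hL => by
    have h1 : ((J : ℕ) + 1 : ℝ) * Real.pi < theta W L 0 := by
      exact_mod_cast lt_theta_of_le hW ((J : ℕ) + 1) hL (by rw [hθ]; push_cast; exact le_rfl)
    exact ⟨analyticAt_branchFreq hW (hLs0.trans hL) h1, (theta_eigBranch hW (hLs0.trans hL) h1).2⟩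
  have hall : ∀ L ∈ Set.Ioi Ls, f L + c J * branchFreq W J L = 0 := by
    have han : AnalyticOnNhd ℝ (fun L => f L + c J * branchFreq W J L) (Set.Ioi Ls) :=
      fun L hL => (hfan L (le_of_lt hL)).add (analyticAt_const.mul (hJan L hL).1)
    exact han.eqOn_zero_of_preconnected_of_eventuallyEq_zero isPreconnected_Ioi
      (z₀ := x) hLsx (hzero.mono fun L hL => (hsum L).symm.trans hL)
  obtain ⟨hnan, hnd⟩ := analyticAt_eigBranch hW hLs0 hθ
  have hn0 : eigBranch W J Ls = 0 := eigBranch_eq hW hLs0 hθ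
  -- Squaring `f = -c_J λ_J` removes the root: `g` vanishes for `L > Ls` and is differentiable at
  -- `Ls` itself.
  set g : ℝ → ℝ := fun L => f L ^ 2 + c J ^ 2 * (L ^ 2 * eigBranch W J L) with hg
  have hg0 : ∀ L ∈ Set.Ioi Ls, g L = 0 := fun L hL => by
    have h1 := hall L hL
    have h2 : √(-eigBranch W J L) ^ 2 = -eigBranch W J L :=
      Real.sq_sqrt (by linarith [(hJan L hL).2])
    have h3 : f L = -(c J * branchFreq W J L) := by linarith
    simp only [hg, h3, branchFreq]
    linear_combination c J ^ 2 * L ^ 2 * h2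
  have hfd := (hfan Ls le_rfl).differentiableAt.hasDerivAt
  have hgd : HasDerivAt g (2 * f Ls * deriv f Ls +
      c J ^ 2 * (Ls ^ 2 * deriv (eigBranch W J) Ls)) Ls := by
    refine ((hfd.pow 2).add ((((hasDerivAt_id Ls).pow 2).mul
      hnan.differentiableAt.hasDerivAt).const_mul (c J ^ 2))).congr_deriv ?_
    simp [hn0]
  have hgLs : g Ls = 0 := by
    have h1 : Tendsto g (𝓝[>] Ls) (𝓝 (g Ls)) :=
      hgd.continuousAt.tendsto.mono_left nhdsWithin_le_nhds
    refine tendsto_nhds_unique h1 (tendsto_const_nhds.congr' ?_)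
    filter_upwards [self_mem_nhdsWithin] with L hL using (hg0 L hL).symm
  have hfLs : f Ls = 0 := by simpa [hg, hn0] using hgLs
  have hder0 : HasDerivWithinAt g 0 (Set.Ici Ls) Ls :=
    (hasDerivWithinAt_const Ls _ (0 : ℝ)).congr (fun L hL => by
      rcases (show Ls ≤ L from hL).eq_or_lt with rfl | hL
      · exact hgLs
      · exact hg0 L hL) hgLs
  -- As `f Ls = 0`, the square `f²` has zero slope at `Ls`, so the right derivative `0` of `g`
  -- equals `c_J² Ls² ν_J'(Ls)`, which is not zero.
  have := (uniqueDiffWithinAt_Ici Ls).eq_deriv _ hgd.hasDerivWithinAt hder0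
  rw [hfLs] at this
  simp [hcJ, hLs0.ne', hnd] at this

end

end ShearFlow

namespace ShearFlow

noncomputable section

/-! ### The even Dirichlet eigenvalues -/

theorem eqOn_zero_of_second_order {c f f' : ℝ → ℝ} (hc : ContinuousOn c (Set.Icc (-1) 1))
    (hf : ∀ y ∈ Set.Icc (-1 : ℝ) 1, HasDerivWithinAt f (f' y) (Set.Icc (-1) 1) y)
    (hf' : ∀ y ∈ Set.Icc (-1 : ℝ) 1, HasDerivWithinAt f' (c y * f y) (Set.Icc (-1) 1) y)
    (h0 : f 0 = 0) (h0' : f' 0 = 0) : Set.EqOn f 0 (Set.Icc (-1) 1) := by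
  obtain ⟨M, hM⟩ := isCompact_Icc.exists_bound_of_continuousOn hc
  have hlip : ∀ t ∈ Set.Ioo (-1 : ℝ) 1, LipschitzOnWith (max 1 M).toNNReal
      (fun p : ℝ × ℝ => (p.2, c t * p.1)) Set.univ := fun t ht => by
    refine LipschitzOnWith.of_dist_le_mul fun p _ q _ => ?_
    rw [Real.coe_toNNReal _ (by positivity), Prod.dist_eq, Prod.dist_eq]
    have h1 : |c t| ≤ M := hM t ⟨ht.1.le, ht.2.le⟩
    have hmax : 0 ≤ max (dist p.1 q.1) (dist p.2 q.2) := le_max_of_le_left dist_nonneg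
    refine max_le ?_ ?_
    · calc dist p.2 q.2 ≤ 1 * max (dist p.1 q.1) (dist p.2 q.2) := by
            rw [one_mul]; exact le_max_right _ _
        _ ≤ _ := mul_le_mul_of_nonneg_right (le_max_left _ _) hmax
    · calc dist (c t * p.1) (c t * q.1) = |c t| * dist p.1 q.1 := by
            rw [Real.dist_eq, Real.dist_eq, ← mul_sub, abs_mul]
        _ ≤ max 1 M * max (dist p.1 q.1) (dist p.2 q.2) :=
          mul_le_mul (h1.trans (le_max_right _ _)) (le_max_left _ _) dist_nonneg (by positivity)
  have hnhds : ∀ t ∈ Set.Ioo (-1 : ℝ) 1, Set.Icc (-1 : ℝ) 1 ∈ 𝓝 t := fun t ht =>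
    Icc_mem_nhds ht.1 ht.2
  have hcont : ContinuousOn (fun y => (f y, f' y)) (Set.Icc (-1) 1) := fun y hy =>
    (hf y hy).continuousWithinAt.prodMk (hf' y hy).continuousWithinAt
  have h := ODE_solution_unique_of_mem_Icc (v := fun t (p : ℝ × ℝ) => (p.2, c t * p.1))
    (t₀ := 0) (f := fun y => (f y, f' y)) (g := fun _ => (0, 0)) hlip (by norm_num) hcont
    (fun t ht => ((hf t ⟨ht.1.le, ht.2.le⟩).hasDerivAt (hnhds t ht)).prodMk
      ((hf' t ⟨ht.1.le, ht.2.le⟩).hasDerivAt (hnhds t ht))) (fun _ _ => Set.mem_univ _)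
    continuousOn_const (fun t _ => (hasDerivAt_const t ((0 : ℝ), (0 : ℝ))).congr_deriv (by ext <;> simp))
    (fun _ _ => Set.mem_univ _) (by simp [h0, h0'])
  exact fun y hy => congrArg Prod.fst (h hy)

theorem psi_neg {W : C(ℝ, ℝ)} (hev : ∀ z, W (-z) = W z) (z ν : ℝ) :
    psi W (-z) ν = psi W z ν := by
  have : scaledCoeff W (-z) ν = scaledCoeff W z ν := by
    ext s
    simp only [scaledCoeff_apply, neg_mul, hev, neg_sq]
  rw [psi, this, psi]

/-- An even eigenfunction has `φ'(0) = 0`, so by uniqueness for the initial value problem it is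
`φ(0)` times the rescaled `psi`. -/
theorem isEigenvalue_iff {W : C(ℝ, ℝ)} (hW : ∀ z, AnalyticAt ℝ (dilate W) z)
    (hev : ∀ z, W (-z) = W z) {L : ℝ} (ν : ℝ) :
    IsEigenvalue (fun y => -L ^ 2 * W (L * y)) (L ^ 2 * ν) ↔ psi W L ν = 0 := by
  have h1 : ∀ y, HasDerivAt (fun y => psi W (L * y) ν) (L * psiDeriv W (L * y) ν) y := fun y => by
    have h : HasDerivAt (fun y => L * y) L y := by simpa using (hasDerivAt_id y).const_mul L
    exact ((hasDerivAt_psi hW (L * y) ν).comp y h).congr_deriv (mul_comm _ _)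
  have h2 : ∀ y, HasDerivAt (fun y => L * psiDeriv W (L * y) ν)
      ((-L ^ 2 * W (L * y) - L ^ 2 * ν) * psi W (L * y) ν) y := fun y => by
    have h : HasDerivAt (fun y => L * y) L y := by simpa using (hasDerivAt_id y).const_mul L
    exact (((hasDerivAt_psiDeriv hW (L * y) ν).comp y h).const_mul L).congr_deriv (by ring)
  constructor
  · rintro ⟨φ, φ', hφ, hφ', heven, -, hφ1, y₀, hy₀, hne⟩
    have hmem : (0 : ℝ) ∈ Set.Icc (-1 : ℝ) 1 := by norm_num
    have hnhds : Set.Icc (-1 : ℝ) 1 ∈ 𝓝 (0 : ℝ) := Icc_mem_nhds (by norm_num) (by norm_num)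
    have hφ'0 : φ' 0 = 0 := by
      have hd := (hφ 0 hmem).hasDerivAt hnhds
      have hd' : HasDerivAt (fun y => φ (-y)) (-φ' 0) 0 := by
        have hd2 : HasDerivAt φ (φ' 0) (-0) := by simpa using hd
        exact (hd2.comp 0 (hasDerivAt_neg 0)).congr_deriv (by ring)
      have := hd'.unique (hd.congr_of_eventuallyEq (by
        filter_upwards [hnhds] with y hy using heven y hy))
      linarith
    have key := eqOn_zero_of_second_order (c := fun y => -L ^ 2 * W (L * y) - L ^ 2 * ν)
      (f := fun y => φ y - φ 0 * psi W (L * y) ν)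
      (f' := fun y => φ' y - φ 0 * (L * psiDeriv W (L * y) ν))
      (Continuous.continuousOn (by fun_prop))
      (fun y hy => (hφ y hy).sub ((h1 y).const_mul (φ 0)).hasDerivWithinAt)
      (fun y hy => ((hφ' y hy).sub ((h2 y).const_mul (φ 0)).hasDerivWithinAt).congr_deriv
        (by ring)) (by simp [psi_zero]) (by simp [psiDeriv_zero, hφ'0])
    have hφ0 : φ 0 ≠ 0 := fun h => hne (by simpa [h] using key hy₀)
    have h := key (show (1 : ℝ) ∈ Set.Icc (-1 : ℝ) 1 by norm_num)
    simpa [hφ1, hφ0] using h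
  · intro h
    refine ⟨_, _, fun y _ => (h1 y).hasDerivWithinAt, fun y _ => (h2 y).hasDerivWithinAt,
      fun y _ => ?_, ?_, ?_, 0, by norm_num, ?_⟩
    · rw [mul_neg, psi_neg hev]
    · rw [mul_neg, psi_neg hev, mul_one, h]
    · rw [mul_one, h]
    · rw [mul_zero, psi_zero]; norm_num

/-- Eigenvalues are the solutions of `θ(L, ·) = (k + 1) π`; monotonicity turns the order of the
eigenvalues into the order of `k`, and the intermediate value theorem supplies every lower level. -/
theorem setOf_isEigenvalue_lt {W : C(ℝ, ℝ)} (hW : ∀ z, AnalyticAt ℝ (dilate W) z)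
    (hev : ∀ z, W (-z) = W z) {L ν : ℝ} {j : ℕ} (hL : 0 < L)
    (h : theta W L ν = (j + 1) * Real.pi) :
    {μ | IsEigenvalue (fun y => -L ^ 2 * W (L * y)) μ ∧ μ < L ^ 2 * ν} =
      (fun i => L ^ 2 * eigBranch W i L) '' (Finset.range j : Set ℕ) := by
  have hmono : StrictMono (theta W L) := fun _ _ h => theta_lt_theta hW hL h
  have hL2 : 0 < L ^ 2 := by positivity
  ext μ
  simp only [Set.mem_ofPred_eq, Set.mem_image, Finset.coe_range, Set.mem_Iio]
  constructor
  · rintro ⟨hμ, hlt⟩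
    obtain ⟨ν', rfl⟩ : ∃ ν', μ = L ^ 2 * ν' := ⟨μ / L ^ 2, by field_simp⟩
    rw [isEigenvalue_iff hW hev, psi_eq_zero_iff_exists hW _ hL.le] at hμ
    obtain ⟨k, hk⟩ := hμ
    refine ⟨k, ?_, by rw [eigBranch_eq hW hL hk]⟩
    have h1 := hmono ((mul_lt_mul_iff_right₀ hL2).1 hlt)
    rw [hk, h, mul_lt_mul_iff_left₀ Real.pi_pos] at h1
    exact_mod_cast (add_lt_add_iff_right (1 : ℝ)).1 h1
  · rintro ⟨i, hi, rfl⟩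
    have hlt : ((i : ℝ) + 1) * Real.pi < (j + 1) * Real.pi := by
      refine mul_lt_mul_of_pos_right ?_ Real.pi_pos
      exact_mod_cast Nat.succ_lt_succ hi
    obtain ⟨ν', hν'⟩ := exists_theta_eq hW i hL (hlt.le.trans h.ge)
    rw [eigBranch_eq hW hL hν', isEigenvalue_iff hW hev, psi_eq_zero_iff_exists hW _ hL.le]
    refine ⟨⟨i, hν'⟩, mul_lt_mul_of_pos_left (hmono.lt_iff_lt.1 ?_) hL2⟩
    rwa [hν', h]

theorem isNthEigenvalue_of_theta_eq {W : C(ℝ, ℝ)} (hW : ∀ z, AnalyticAt ℝ (dilate W) z)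
    (hev : ∀ z, W (-z) = W z) {L ν : ℝ} {j : ℕ} (hL : 0 < L)
    (h : theta W L ν = (j + 1) * Real.pi) :
    IsNthEigenvalue (fun y => -L ^ 2 * W (L * y)) j (L ^ 2 * ν) := by
  have hL2 : L ^ 2 ≠ 0 := by positivity
  refine ⟨(isEigenvalue_iff hW hev ν).2 ((psi_eq_zero_iff_exists hW ν hL.le).2 ⟨j, h⟩), ?_⟩
  rw [setOf_isEigenvalue_lt hW hev hL h, Set.InjOn.encard_image, Set.encard_coe_eq_coe_finsetCard,
    Finset.card_range]
  intro i hi i' hi' he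
  have hex : ∀ i ∈ (Finset.range j : Set ℕ), theta W L (eigBranch W i L) = (i + 1) * Real.pi := by
    intro i hi
    have hi : i < j := by simpa using hi
    obtain ⟨ν', hν'⟩ := exists_theta_eq hW i hL (ν₀ := ν) (by
      rw [h]
      refine mul_le_mul_of_nonneg_right ?_ Real.pi_pos.le
      exact_mod_cast Nat.succ_le_succ hi.le)
    rwa [eigBranch_eq hW hL hν']
  have h1 : eigBranch W i L = eigBranch W i' L := mul_left_cancel₀ hL2 he
  have h2 := hex i hi
  rw [h1, hex i' hi', mul_left_inj' Real.pi_ne_zero] at h2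
  exact_mod_cast (add_left_injective (1 : ℝ) h2).symm

theorem IsNthEigenvalue.unique {Q : ℝ → ℝ} {j : ℕ} {μ μ' : ℝ} (h : IsNthEigenvalue Q j μ)
    (h' : IsNthEigenvalue Q j μ') : μ = μ' := by
  wlog hlt : μ < μ' generalizing μ μ'
  · rcases eq_or_lt_of_le (not_lt.1 hlt) with h1 | h1
    · exact h1.symm
    · exact (this h' h h1).symm
  exfalso
  have hsub : insert μ {ν | IsEigenvalue Q ν ∧ ν < μ} ⊆ {ν | IsEigenvalue Q ν ∧ ν < μ'} := by
    rintro ν (rfl | hν)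
    · exact ⟨h.1, hlt⟩
    · exact ⟨hν.1, hν.2.trans hlt⟩
  have hcard := Set.encard_le_encard hsub
  rw [Set.encard_insert_of_notMem (by simp), h.2, h'.2] at hcard
  have : j + 1 ≤ j := by exact_mod_cast hcard
  omega

theorem IsNthEigenvalue.nthEigenvalue_eq {Q : ℝ → ℝ} {j : ℕ} {μ : ℝ} (h : IsNthEigenvalue Q j μ) :
    nthEigenvalue Q j = μ := by
  have : {μ : ℝ | IsNthEigenvalue Q j μ} = {μ} :=
    Set.eq_singleton_iff_unique_mem.2 ⟨h, fun ν hν => IsNthEigenvalue.unique hν h⟩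
  rw [nthEigenvalue, this, csInf_singleton]

end

end ShearFlow

namespace ShearFlow

noncomputable section

open scoped unitInterval
open Polynomial

/-! ### Analyticity of the potential -/

/-- The inclusion `[0, 1] → ℝ`, as an element of the Banach algebra `C([0, 1], ℝ)`. -/
def coordFun : C(I, ℝ) := ⟨fun s => s, continuous_subtype_val⟩

theorem exp_apply (f : C(I, ℝ)) (s : I) : NormedSpace.exp f s = Real.exp (f s) := by
  rw [Real.exp_eq_exp_ℝ]
  exact NormedSpace.map_exp (ContinuousMap.evalAlgHom ℝ ℝ s) (continuous_eval_const s) f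

theorem analyticAt_smul_coordFun (z : ℝ) : AnalyticAt ℝ (fun z : ℝ => z • coordFun) z :=
  analyticAt_id.smul analyticAt_const

theorem analyticAt_dilate_polynomial (p : ℝ[X]) (z : ℝ) :
    AnalyticAt ℝ (dilate ⟨fun x => p.eval x, p.continuous⟩) z := by
  have h := (analyticAt_smul_coordFun z).aeval_polynomial p
  refine h.congr (Eventually.of_forall fun z => ?_)
  ext s
  simp only
  rw [aeval_continuousMap_apply, dilate_apply]
  simp [coordFun]

theorem continuous_stepFun (m : ℕ) : Continuous (stepFun m) := by
  unfold stepFun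
  refine Continuous.inv₀ (by fun_prop) fun z => ?_
  have := Real.cosh_pos z
  have := Real.cosh_pos 1
  positivity

/-- The whole curve is built inside the Banach algebra `C([0, 1], ℝ)` from exponentials of `z •
coordFun`, a power and an inverse; the denominator is a unit because it is positive at each point.
-/
theorem analyticAt_dilate_stepFun (m : ℕ) (z : ℝ) :
    AnalyticAt ℝ (dilate ⟨stepFun m, continuous_stepFun m⟩) z := by
  set D : ℝ → C(I, ℝ) := fun z => ((Real.cosh 1)⁻¹ • ((2 : ℝ)⁻¹ • (NormedSpace.exp (z • coordFun) +
    NormedSpace.exp (-(z • coordFun))))) ^ m + 1 with hD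
  have hDapp : ∀ z s, D z s = (Real.cosh (z * s) / Real.cosh 1) ^ m + 1 := fun z s => by
    simp only [hD, ContinuousMap.add_apply, ContinuousMap.pow_apply, ContinuousMap.smul_apply,
      exp_apply, ContinuousMap.neg_apply, ContinuousMap.one_apply, smul_eq_mul]
    rw [Real.cosh_eq (z * s), div_eq_inv_mul, div_eq_inv_mul]
    rfl
  have hDunit : ∀ z, IsUnit (D z) := fun z => by
    refine (ContinuousMap.isUnit_iff_forall_ne_zero _).2 fun s => ?_
    rw [hDapp]
    have := Real.cosh_pos (z * s)
    have := Real.cosh_pos 1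
    positivity
  have hexp : ∀ f : C(I, ℝ), AnalyticAt ℝ (NormedSpace.exp : C(I, ℝ) → C(I, ℝ)) f :=
    fun f => NormedSpace.exp_analytic f
  have h1 := analyticAt_smul_coordFun z
  have hDan : AnalyticAt ℝ D z := by
    refine AnalyticAt.add (AnalyticAt.pow (AnalyticAt.smul (f := fun _ => (Real.cosh 1)⁻¹)
      analyticAt_const (AnalyticAt.smul (f := fun _ => (2 : ℝ)⁻¹) analyticAt_const
      (AnalyticAt.add ?_ ?_))) m) analyticAt_const
    · exact AnalyticAt.fun_comp (hexp _) h1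
    · exact AnalyticAt.fun_comp (hexp _) h1.neg
  have hinv : AnalyticAt ℝ (fun z => Ring.inverse (D z)) z := by
    obtain ⟨w, hw⟩ := hDunit z
    have h2 : AnalyticAt ℝ Ring.inverse (D z) := hw ▸ analyticAt_inverse w
    exact AnalyticAt.fun_comp h2 hDan
  refine hinv.congr (Eventually.of_forall fun z => ?_)
  ext s
  have h3 := congrArg (fun f : C(I, ℝ) => f s) (Ring.mul_inverse_cancel _ (hDunit z))
  simp only [ContinuousMap.mul_apply, hDapp, ContinuousMap.one_apply] at h3
  exact eq_inv_of_mul_eq_one_right h3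

/-- The potential in the rescaled variable: `a² (h_m + g_{m,S})`. -/
def wellPotential {κ₀ : ℕ} (m S : ℕ) (T : ℝ) (y : Fin κ₀ → ℝ) : C(ℝ, ℝ) :=
  wellConst κ₀ ^ 2 • (⟨stepFun m, continuous_stepFun m⟩ +
    ⟨fun x => (corrector m S T y).eval x, (corrector m S T y).continuous⟩)

theorem wellPotential_apply {κ₀ : ℕ} (m S : ℕ) (T : ℝ) (y : Fin κ₀ → ℝ) (z : ℝ) :
    wellPotential m S T y z =
      wellConst κ₀ ^ 2 * (stepFun m z + (corrector m S T y).eval z) := rfl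

theorem dilate_wellPotential {κ₀ : ℕ} (m S : ℕ) (T : ℝ) (y : Fin κ₀ → ℝ) (z : ℝ) :
    dilate (wellPotential m S T y) z =
      wellConst κ₀ ^ 2 • (dilate ⟨stepFun m, continuous_stepFun m⟩ z +
        dilate ⟨fun x => (corrector m S T y).eval x, (corrector m S T y).continuous⟩ z) := rfl

theorem analyticAt_dilate_wellPotential {κ₀ : ℕ} (m S : ℕ) (T : ℝ) (y : Fin κ₀ → ℝ) (z : ℝ) :
    AnalyticAt ℝ (dilate (wellPotential m S T y)) z := by
  simp only [funext (dilate_wellPotential m S T y)]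
  exact AnalyticAt.smul (f := fun _ => wellConst κ₀ ^ 2) analyticAt_const
    ((analyticAt_dilate_stepFun m z).add (analyticAt_dilate_polynomial _ z))

theorem wellConst_pos (κ₀ : ℕ) : 0 < wellConst κ₀ := by
  unfold wellConst
  positivity

theorem potential_eq {κ₀ : ℕ} (m S : ℕ) (T : ℝ) (y : Fin κ₀ → ℝ) (E : ℝ) :
    potential m S T y E = fun x =>
      -(E / wellConst κ₀) ^ 2 * wellPotential m S T y (E / wellConst κ₀ * x) := by
  funext x
  have := (wellConst_pos κ₀).ne'
  rw [potential, wellPotential_apply, show x / (wellConst κ₀ / E) = E / wellConst κ₀ * x by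
    rw [div_div_eq_mul_div]; ring]
  field_simp

/-! ### The corrector is even -/

theorem stepFun_neg (m : ℕ) (z : ℝ) : stepFun m (-z) = stepFun m z := by
  simp [stepFun, Real.cosh_neg]

theorem iteratedDeriv_odd_stepFun_neg (m k : ℕ) (z : ℝ) :
    iteratedDeriv (2 * k + 1) (stepFun m) (-z) = -iteratedDeriv (2 * k + 1) (stepFun m) z := by
  have h := iteratedDeriv_comp_neg (2 * k + 1) (stepFun m) (-z)
  simp only [stepFun_neg, neg_neg] at h
  rw [h, Odd.neg_one_pow ⟨k, rfl⟩, neg_one_smul]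

theorem iterate_derivative_comp_neg_X (p : ℝ[X]) (n : ℕ) :
    derivative^[n] (p.comp (-X)) = (-1) ^ n * (derivative^[n] p).comp (-X) := by
  induction n generalizing p with
  | zero => simp
  | succ n ih => simp [ih (derivative p), derivative_comp, pow_succ]

section

variable {ι : Type*} [Fintype ι] [DecidableEq ι] (m S : ℕ) (T : ℝ) {ν : ι → ℝ} (e : ι ≃ ι)

theorem hatPoly_comp_neg_X (he : ∀ i, ν (e i) = -ν i) (j : ι) :
    (hatPoly S T ν (e j)).comp (-X) = hatPoly S T ν j := by
  have hprod : ∏ i ∈ Finset.univ.erase (e j), ((X - C (ν i)) ^ (2 * S)).comp (-X) =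
      ∏ i ∈ Finset.univ.erase j, (X - C (ν i)) ^ (2 * S) := by
    symm
    refine Finset.prod_bij (fun i _ => e i) ?_ ?_ ?_ ?_
    · intro i hi
      simpa using hi
    · intro i _ i' _ h
      exact e.injective h
    · intro i hi
      exact ⟨e.symm i, by simpa [Equiv.symm_apply_eq] using hi, by simp⟩
    · intro i _
      rw [he, pow_comp, sub_comp, X_comp, C_comp, C_neg,
        show (-X - -C (ν i) : ℝ[X]) = -(X - C (ν i)) by ring, Even.neg_pow ⟨S, two_mul S⟩]
  rw [hatPoly, hatPoly, mul_comp, prod_comp, hprod]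
  simp

theorem oddPoly_comp_neg_X (he : ∀ i, ν (e i) = -ν i) (j : ι) (k : ℕ) :
    (oddPoly S T ν (e j) k).comp (-X) = -oddPoly S T ν j k := by
  rw [oddPoly, oddPoly, mul_comp, mul_comp, hatPoly_comp_neg_X S T e he, C_comp, pow_comp,
    sub_comp, X_comp, C_comp, he, C_neg, show (-X - -C (ν j) : ℝ[X]) = -(X - C (ν j)) by ring,
    Odd.neg_pow ⟨k, rfl⟩]
  ring

theorem oddPoly_perm (he : ∀ i, ν (e i) = -ν i) (j : ι) (k : ℕ) :
    oddPoly S T ν (e j) k = -(oddPoly S T ν j k).comp (-X) := by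
  rw [← neg_comp, ← oddPoly_comp_neg_X S T e he, comp_assoc]
  simp

/-- Reflecting the node leaves the matrix of the triangular system unchanged and flips the sign of
the right-hand side, since odd derivatives of the even function `h_m` are odd. -/
theorem corrCoeff_perm (he : ∀ i, ν (e i) = -ν i) (j : ι) (k : ℕ) :
    corrCoeff m S T ν (e j) k = -corrCoeff m S T ν j k := by
  induction k using Nat.strong_induction_on with
  | _ k ih =>
    have hden : (hatPoly S T ν (e j)).eval (ν (e j)) = (hatPoly S T ν j).eval (ν j) := by
      rw [← hatPoly_comp_neg_X S T e he j, eval_comp, he]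
      simp
    have hder : ∀ n, (derivative^[2 * k + 1] (oddPoly S T ν (e j) n)).eval (ν (e j)) =
        (derivative^[2 * k + 1] (oddPoly S T ν j n)).eval (ν j) := fun n => by
      rw [oddPoly_perm S T e he, iterate_derivative_neg, iterate_derivative_comp_neg_X,
        Odd.neg_one_pow ⟨k, rfl⟩, he]
      simp
    rw [corrCoeff, corrCoeff, hden, he, iteratedDeriv_odd_stepFun_neg, ← neg_div]
    congr 1
    simp only [← he, hder]
    rw [Finset.sum_congr rfl fun n _ => by rw [ih n n.2]]
    simp only [neg_mul, Finset.sum_neg_distrib]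
    ring

theorem corrPoly_comp_neg_X (he : ∀ i, ν (e i) = -ν i) :
    (corrPoly m S T ν).comp (-X) = corrPoly m S T ν := by
  rw [corrPoly, Polynomial.sum_comp, ← Equiv.sum_comp e]
  refine Finset.sum_congr rfl fun j _ => ?_
  rw [Polynomial.sum_comp]
  refine Finset.sum_congr rfl fun k _ => ?_
  rw [mul_comp, C_comp, oddPoly_comp_neg_X S T e he, corrCoeff_perm m S T e he, C_neg]
  ring

end

theorem wellPotential_neg {κ₀ : ℕ} (m S : ℕ) (T : ℝ) (y : Fin κ₀ → ℝ) (z : ℝ) :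
    wellPotential m S T y (-z) = wellPotential m S T y z := by
  have h := corrPoly_comp_neg_X m S T (ν := signed y) (Equiv.sumComm _ _) (by
    rintro (i | i) <;> simp [signed])
  rw [wellPotential_apply, wellPotential_apply, stepFun_neg, corrector, ← h, eval_comp]
  simp [h]

end

end ShearFlow

namespace ShearFlow

noncomputable section

open scoped unitInterval
open Polynomial

/-! ### The regularised step function for large `m` -/

theorem cosh_div_cosh_one_pow_le {q z : ℝ} (h : |z| ≤ q) (m : ℕ) :
    (Real.cosh z / Real.cosh 1) ^ m ≤ (Real.cosh q / Real.cosh 1) ^ m := by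
  have h1 := Real.cosh_pos z
  have h2 := Real.cosh_pos 1
  have h3 : Real.cosh z ≤ Real.cosh q := Real.cosh_le_cosh.2 (h.trans (le_abs_self q))
  gcongr

theorem stepFun_mem_Ioo (m : ℕ) (z : ℝ) : stepFun m z ∈ Set.Ioo (0 : ℝ) 1 := by
  have h1 := Real.cosh_pos z
  have h2 := Real.cosh_pos 1
  have h : 0 < (Real.cosh z / Real.cosh 1) ^ m := by positivity
  exact ⟨by unfold stepFun; positivity, inv_lt_one_of_one_lt₀ (by linarith)⟩

theorem one_sub_stepFun_le (m : ℕ) {q z : ℝ} (h : |z| ≤ q) :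
    1 - stepFun m z ≤ (Real.cosh q / Real.cosh 1) ^ m := by
  refine le_trans ?_ (cosh_div_cosh_one_pow_le h m)
  have h1 := Real.cosh_pos z
  have h2 := Real.cosh_pos 1
  set w := (Real.cosh z / Real.cosh 1) ^ m with hw
  have hpos : 0 < w := by positivity
  rw [stepFun, ← hw, sub_le_iff_le_add, inv_eq_one_div, ← sub_le_iff_le_add', le_div_iff₀ (by linarith)]
  nlinarith

theorem hasDerivAt_stepFun (m : ℕ) (z : ℝ) :
    HasDerivAt (stepFun m) (-(m * Real.tanh z * (stepFun m z * (1 - stepFun m z)))) z := by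
  have h1 := Real.cosh_pos z
  have h2 := Real.cosh_pos 1
  have hpos : 0 < (Real.cosh z / Real.cosh 1) ^ m := by positivity
  have h := ((((Real.hasDerivAt_cosh z).div_const (Real.cosh 1)).pow m).add_const 1).inv
    (by simp only [Pi.pow_apply]; positivity)
  refine h.congr_deriv ?_
  simp only [Pi.pow_apply, stepFun, Real.tanh_eq_sinh_div_cosh]
  rcases m with _ | m
  · simp
  · have h3 : (Real.cosh z / Real.cosh 1) ^ (m + 1) + 1 ≠ 0 := by positivity
    field_simp
    simp only [Nat.add_sub_cancel, pow_succ]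
    field_simp
    ring

theorem hasDerivAt_tanh (z : ℝ) : HasDerivAt Real.tanh (1 - Real.tanh z ^ 2) z := by
  have h1 := (Real.cosh_pos z).ne'
  have h := (Real.hasDerivAt_sinh z).div (Real.hasDerivAt_cosh z) h1
  have e : Real.tanh = fun x => Real.sinh x / Real.cosh x :=
    funext Real.tanh_eq_sinh_div_cosh
  rw [e]
  refine h.congr_deriv ?_
  field_simp

/-- Families of functions that are polynomials in `m`, `tanh z` and `h_m(z)`. -/
def stepAlgebra : Subalgebra ℝ (ℕ → ℝ → ℝ) :=
  Algebra.adjoin ℝ {(fun (m : ℕ) (_ : ℝ) => (m : ℝ)), fun (_ : ℕ) => Real.tanh, stepFun}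

theorem cast_mem_stepAlgebra : (fun (m : ℕ) (_ : ℝ) => (m : ℝ)) ∈ stepAlgebra :=
  Algebra.subset_adjoin (by simp)

theorem tanh_mem_stepAlgebra : (fun (_ : ℕ) => Real.tanh) ∈ stepAlgebra :=
  Algebra.subset_adjoin (by simp)

theorem stepFun_mem_stepAlgebra : stepFun ∈ stepAlgebra :=
  Algebra.subset_adjoin (by simp)

/-- The algebra is closed under `d/dz` because `tanh' = 1 - tanh²` and `h_m' = -m tanh · h_m (1 -
h_m)`. -/
theorem exists_hasDerivAt_of_mem_stepAlgebra {f : ℕ → ℝ → ℝ} (hf : f ∈ stepAlgebra) :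
    ∃ f' ∈ stepAlgebra, ∀ m z, HasDerivAt (f m) (f' m z) z := by
  rw [stepAlgebra] at hf
  induction hf using Algebra.adjoin_induction with
  | mem f hf =>
    simp only [Set.mem_insert_iff, Set.mem_singleton_iff] at hf
    rcases hf with rfl | rfl | rfl
    · exact ⟨0, zero_mem _, fun m z => hasDerivAt_const z _⟩
    · exact ⟨1 - (fun (_ : ℕ) => Real.tanh) ^ 2, sub_mem (one_mem _) (pow_mem tanh_mem_stepAlgebra 2),
        fun m z => hasDerivAt_tanh z⟩
    · exact ⟨-((fun (m : ℕ) (_ : ℝ) => (m : ℝ)) * (fun (_ : ℕ) => Real.tanh) * (stepFun * (1 - stepFun))),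
        neg_mem (mul_mem (mul_mem cast_mem_stepAlgebra tanh_mem_stepAlgebra)
          (mul_mem stepFun_mem_stepAlgebra (sub_mem (one_mem _) stepFun_mem_stepAlgebra))),
        fun m z => hasDerivAt_stepFun m z⟩
  | algebraMap r => exact ⟨0, zero_mem _, fun m z => hasDerivAt_const z _⟩
  | add f g _ _ ihf ihg =>
    obtain ⟨f', hf', hf⟩ := ihf
    obtain ⟨g', hg', hg⟩ := ihg
    exact ⟨f' + g', add_mem hf' hg', fun m z => (hf m z).add (hg m z)⟩
  | mul f g hfm hgm ihf ihg =>
    obtain ⟨f', hf', hf⟩ := ihf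
    obtain ⟨g', hg', hg⟩ := ihg
    exact ⟨f' * g + f * g', add_mem (mul_mem hf' hgm) (mul_mem hfm hg'),
      fun m z => (hf m z).mul (hg m z)⟩

theorem exists_abs_le_of_mem_stepAlgebra {f : ℕ → ℝ → ℝ} (hf : f ∈ stepAlgebra) :
    ∃ K N, 0 ≤ K ∧ ∀ (m : ℕ) (z : ℝ), |f m z| ≤ K * ((m : ℝ) + 1) ^ (N : ℕ) := by
  rw [stepAlgebra] at hf
  induction hf using Algebra.adjoin_induction with
  | mem f hf =>
    simp only [Set.mem_insert_iff, Set.mem_singleton_iff] at hf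
    rcases hf with rfl | rfl | rfl
    · refine ⟨1, 1, zero_le_one, fun m z => ?_⟩
      rw [Nat.abs_cast]
      linarith
    · exact ⟨1, 0, zero_le_one, fun m z => by simpa using (Real.abs_tanh_lt_one z).le⟩
    · refine ⟨1, 0, zero_le_one, fun m z => ?_⟩
      have := stepFun_mem_Ioo m z
      rw [abs_of_pos this.1]
      simpa using this.2.le
  | algebraMap r => exact ⟨|r|, 0, abs_nonneg r, fun m z => by simp⟩
  | add f g _ _ ihf ihg =>
    obtain ⟨K, N, hK, hf⟩ := ihf
    obtain ⟨K', N', hK', hg⟩ := ihg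
    refine ⟨K + K', N + N', add_nonneg hK hK', fun m z => ?_⟩
    have h1 : (1 : ℝ) ≤ (m : ℝ) + 1 := by linarith [(Nat.cast_nonneg m : (0 : ℝ) ≤ m)]
    calc |f m z + g m z| ≤ |f m z| + |g m z| := abs_add_le _ _
      _ ≤ K * ((m : ℝ) + 1) ^ (N + N') + K' * ((m : ℝ) + 1) ^ (N + N') := by
        refine add_le_add ((hf m z).trans ?_) ((hg m z).trans ?_)
        · exact mul_le_mul_of_nonneg_left (pow_le_pow_right₀ h1 (by omega)) hK
        · exact mul_le_mul_of_nonneg_left (pow_le_pow_right₀ h1 (by omega)) hK'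
      _ = _ := by ring
  | mul f g _ _ ihf ihg =>
    obtain ⟨K, N, hK, hf⟩ := ihf
    obtain ⟨K', N', hK', hg⟩ := ihg
    refine ⟨K * K', N + N', mul_nonneg hK hK', fun m z => ?_⟩
    calc |f m z * g m z| = |f m z| * |g m z| := abs_mul _ _
      _ ≤ (K * ((m : ℝ) + 1) ^ N) * (K' * ((m : ℝ) + 1) ^ N') :=
        mul_le_mul (hf m z) (hg m z) (abs_nonneg _) (by positivity)
      _ = _ := by ring

/-- Every derivative of positive order keeps the factor `h_m (1 - h_m)`, which is exponentially
small in `m` inside the well, while the cofactor grows at most polynomially in `m`. -/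
theorem exists_iteratedDeriv_stepFun_eq (n : ℕ) : ∃ f ∈ stepAlgebra, ∀ m,
    iteratedDeriv (n + 1) (stepFun m) = fun z => f m z * (stepFun m z * (1 - stepFun m z)) := by
  induction n with
  | zero =>
    refine ⟨-((fun (m : ℕ) (_ : ℝ) => (m : ℝ)) * (fun (_ : ℕ) => Real.tanh)),
      neg_mem (mul_mem cast_mem_stepAlgebra tanh_mem_stepAlgebra), fun m => funext fun z => ?_⟩
    rw [iteratedDeriv_one, (hasDerivAt_stepFun m z).deriv]
    simp
  | succ n ih =>
    obtain ⟨f, hfm, hf⟩ := ih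
    obtain ⟨f', hf'm, hf'⟩ := exists_hasDerivAt_of_mem_stepAlgebra hfm
    refine ⟨f' + f * ((1 - 2 * stepFun) * -((fun (m : ℕ) (_ : ℝ) => (m : ℝ)) * (fun (_ : ℕ) => Real.tanh))),
      add_mem hf'm (mul_mem hfm (mul_mem (sub_mem (one_mem _)
        (mul_mem (ofNat_mem _ 2) stepFun_mem_stepAlgebra))
        (neg_mem (mul_mem cast_mem_stepAlgebra tanh_mem_stepAlgebra)))),
      fun m => funext fun z => ?_⟩
    rw [iteratedDeriv_succ, hf m]
    have h := hasDerivAt_stepFun m z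
    refine (((hf' m z).mul (h.mul (h.const_sub 1))).congr_deriv ?_).deriv
    simp only [Pi.add_apply, Pi.mul_apply, Pi.sub_apply, Pi.neg_apply,
      Pi.ofNat_apply]
    ring

theorem cosh_div_cosh_one_lt_one {q : ℝ} (hq0 : 0 ≤ q) (hq : q < 1) :
    Real.cosh q / Real.cosh 1 < 1 := by
  rw [div_lt_one (Real.cosh_pos 1), Real.cosh_lt_cosh, abs_of_nonneg hq0, abs_one]
  exact hq

theorem tendsto_iteratedDeriv_stepFun (n : ℕ) {x : ℕ → ℝ} {x₀ : ℝ} (hx : Tendsto x atTop (𝓝 x₀))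
    (hx₀ : |x₀| < 1) : Tendsto (fun m => iteratedDeriv (n + 1) (stepFun m) (x m)) atTop (𝓝 0) := by
  obtain ⟨q, hq0, hq1⟩ := exists_between hx₀
  have hqpos : 0 ≤ q := (abs_nonneg _).trans hq0.le
  obtain ⟨f, hfm, hf⟩ := exists_iteratedDeriv_stepFun_eq n
  obtain ⟨K, N, hK, hb⟩ := exists_abs_le_of_mem_stepAlgebra hfm
  set r := Real.cosh q / Real.cosh 1 with hr
  have hr0 : 0 < r := div_pos (Real.cosh_pos q) (Real.cosh_pos 1)
  have hr1 : r < 1 := cosh_div_cosh_one_lt_one hqpos hq1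
  have hlim : Tendsto (fun m : ℕ => K * r⁻¹ * (((m + 1 : ℕ) : ℝ) ^ N * r ^ (m + 1))) atTop (𝓝 0) := by
    have := ((tendsto_pow_const_mul_const_pow_of_lt_one N hr0.le hr1).comp
      (tendsto_add_atTop_nat 1)).const_mul (K * r⁻¹)
    simpa using this
  refine squeeze_zero_norm' ?_ hlim
  filter_upwards [hx.abs.eventually (gt_mem_nhds hq0)] with m hm
  rw [hf m, Real.norm_eq_abs, abs_mul]
  have h1 := stepFun_mem_Ioo m (x m)
  have h2 : |stepFun m (x m) * (1 - stepFun m (x m))| ≤ r ^ m := by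
    rw [abs_of_nonneg (mul_nonneg h1.1.le (by linarith [h1.2]))]
    have := one_sub_stepFun_le m hm.le
    nlinarith [h1.1, h1.2]
  calc _ ≤ (K * ((m : ℝ) + 1) ^ N) * r ^ m := mul_le_mul (hb _ _) h2 (abs_nonneg _) (by positivity)
    _ = _ := by
      push_cast
      rw [pow_succ]
      field_simp

theorem tendsto_dilate_stepFun {z : ℝ} (hz0 : 0 ≤ z) (hz : z < 1) :
    Tendsto (fun m => dilate ⟨stepFun m, continuous_stepFun m⟩ z) atTop (𝓝 1) := by
  rw [tendsto_iff_norm_sub_tendsto_zero]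
  refine squeeze_zero (fun _ => norm_nonneg _) (fun m => ?_)
    (tendsto_pow_atTop_nhds_zero_of_lt_one (div_pos (Real.cosh_pos z) (Real.cosh_pos 1)).le
      (cosh_div_cosh_one_lt_one hz0 hz))
  have hpos : 0 < (Real.cosh z / Real.cosh 1) ^ m :=
    pow_pos (div_pos (Real.cosh_pos z) (Real.cosh_pos 1)) m
  refine (ContinuousMap.norm_le _ hpos.le).2 fun s => ?_
  have hs : |z * s| ≤ z := by
    rw [abs_of_nonneg (mul_nonneg hz0 s.2.1)]
    exact mul_le_of_le_one_right hz0 s.2.2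
  have h1 := stepFun_mem_Ioo m (z * s)
  rw [ContinuousMap.sub_apply, dilate_apply, ContinuousMap.one_apply, Real.norm_eq_abs, abs_sub_comm]
  change |1 - stepFun m (z * s)| ≤ _
  rw [abs_of_pos (by linarith [h1.2])]
  exact one_sub_stepFun_le m hs

/-! ### The corrector tends to zero -/

section

variable {ι : Type*} [Fintype ι] [DecidableEq ι]

/-- Families of polynomials all of whose derivatives are jointly continuous. -/
def IsSmoothFamily {X : Type*} [TopologicalSpace X] (P : X → ℝ[X]) : Prop :=
  ∀ n, Continuous fun x : X × ℝ => (derivative^[n] (P x.1)).eval x.2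

theorem IsSmoothFamily.mul {X : Type*} [TopologicalSpace X] {P Q : X → ℝ[X]}
    (hP : IsSmoothFamily P) (hQ : IsSmoothFamily Q) : IsSmoothFamily fun x => P x * Q x := by
  intro n
  simp only [iterate_derivative_mul, eval_finsetSum, eval_smul, eval_mul]
  exact continuous_finsetSum _ fun k _ => ((hP (n - k)).mul (hQ k)).const_smul (n.choose k)

theorem IsSmoothFamily.const {X : Type*} [TopologicalSpace X] (p : ℝ[X]) :
    IsSmoothFamily fun _ : X => p := fun n => by
  exact (Polynomial.continuous _).comp continuous_snd

theorem IsSmoothFamily.pow {X : Type*} [TopologicalSpace X] {P : X → ℝ[X]}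
    (hP : IsSmoothFamily P) (n : ℕ) : IsSmoothFamily fun x => P x ^ n := by
  induction n with
  | zero => simpa using IsSmoothFamily.const 1
  | succ n ih => simpa only [pow_succ] using ih.mul hP

theorem IsSmoothFamily.prod {X κ : Type*} [TopologicalSpace X] {P : κ → X → ℝ[X]} (s : Finset κ)
    (hP : ∀ i ∈ s, IsSmoothFamily (P i)) : IsSmoothFamily fun x => ∏ i ∈ s, P i x := by
  classical
  induction s using Finset.induction_on with
  | empty => simpa using IsSmoothFamily.const 1
  | insert i s hi ih =>
    simp only [Finset.prod_insert hi]
    exact (hP i (by simp)).mul (ih fun i' hi' => hP i' (by simp [hi']))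

theorem isSmoothFamily_X_sub_C {κ : Type*} (i : κ) : IsSmoothFamily fun ν : κ → ℝ => X - C (ν i) := by
  rintro (_ | _ | n)
  · simp only [Function.iterate_zero, id_eq, eval_sub, eval_X, eval_C]
    fun_prop
  · simpa using continuous_const
  · simpa [Function.iterate_succ] using continuous_const

theorem isSmoothFamily_hatPoly (S : ℕ) (T : ℝ) (j : ι) :
    IsSmoothFamily fun ν : ι → ℝ => hatPoly S T ν j :=
  (IsSmoothFamily.const _).mul (IsSmoothFamily.prod _ fun i _ => (isSmoothFamily_X_sub_C i).pow _)

theorem isSmoothFamily_oddPoly (S : ℕ) (T : ℝ) (j : ι) (k : ℕ) :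
    IsSmoothFamily fun ν : ι → ℝ => oddPoly S T ν j k :=
  ((IsSmoothFamily.const _).mul ((isSmoothFamily_X_sub_C j).pow _)).mul
    (isSmoothFamily_hatPoly S T j)

theorem hatPoly_eval_ne_zero (S : ℕ) {T : ℝ} {ν : ι → ℝ} (hinj : Function.Injective ν)
    (hT : ∀ i, |ν i| < T) (j : ι) : (hatPoly S T ν j).eval (ν j) ≠ 0 := by
  rw [hatPoly, eval_mul, eval_prod]
  refine mul_ne_zero ?_ (Finset.prod_ne_zero_iff.2 fun i hi => ?_)
  · rw [eval_pow]
    refine pow_ne_zero _ ?_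
    have := hT j
    have h2 : ν j ^ 2 < T ^ 2 := sq_lt_sq' (by linarith [(abs_lt.1 this).1]) (abs_lt.1 this).2
    simp only [eval_sub, eval_pow, eval_X, eval_C]
    linarith
  · rw [eval_pow]
    refine pow_ne_zero _ ?_
    simp only [eval_sub, eval_X, eval_C]
    exact sub_ne_zero.2 fun h => (Finset.ne_of_mem_erase hi) (hinj h).symm

/-- Induction along the triangular system: its data tend to `0`, and its matrix tends to the one at
the limit nodes, whose diagonal entry is nonzero as these nodes are distinct and lie in `(-T, T)`.
-/
theorem tendsto_corrCoeff (S : ℕ) {T : ℝ} {ν : ℕ → ι → ℝ} {ν₀ : ι → ℝ}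
    (hν : Tendsto ν atTop (𝓝 ν₀)) (hinj : Function.Injective ν₀) (hlt : ∀ i, |ν₀ i| < 1)
    (hT : 1 ≤ T) (j : ι) (k : ℕ) :
    Tendsto (fun m => corrCoeff m S T (ν m) j k) atTop (𝓝 0) := by
  have hνj : Tendsto (fun m => ν m j) atTop (𝓝 (ν₀ j)) := tendsto_pi_nhds.1 hν j
  have hpair : Tendsto (fun m => (ν m, ν m j)) atTop (𝓝 (ν₀, ν₀ j)) := hν.prodMk_nhds hνj
  induction k using Nat.strong_induction_on with
  | _ k ih =>
    have hnum : Tendsto (fun m => -iteratedDeriv (2 * k + 1) (stepFun m) (ν m j)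
      - ∑ n : Fin k, corrCoeff m S T (ν m) j n *
          (derivative^[2 * k + 1] (oddPoly S T (ν m) j n)).eval (ν m j)) atTop (𝓝 (-0 -
          ∑ n : Fin k, 0 * (derivative^[2 * k + 1] (oddPoly S T ν₀ j n)).eval (ν₀ j))) := by
      refine (tendsto_iteratedDeriv_stepFun _ hνj (hlt j)).neg.sub
        (tendsto_finsetSum _ fun n _ => (ih n n.2).mul ?_)
      exact ((isSmoothFamily_oddPoly S T j n (2 * k + 1)).tendsto (ν₀, ν₀ j)).comp hpair
    have hden : Tendsto (fun m => (hatPoly S T (ν m) j).eval (ν m j)) atTop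
        (𝓝 ((hatPoly S T ν₀ j).eval (ν₀ j))) :=
      ((isSmoothFamily_hatPoly S T j 0).tendsto (ν₀, ν₀ j)).comp hpair
    have h := hnum.div hden (hatPoly_eval_ne_zero S hinj (fun i => (hlt i).trans_le hT) j)
    simp only [zero_mul, Finset.sum_const_zero, neg_zero, sub_zero, zero_div] at h
    refine h.congr fun m => ?_
    rw [Pi.div_apply, corrCoeff]

theorem tendsto_dilate_corrPoly (S : ℕ) {T : ℝ} {ν : ℕ → ι → ℝ} {ν₀ : ι → ℝ}
    (hν : Tendsto ν atTop (𝓝 ν₀)) (hinj : Function.Injective ν₀) (hlt : ∀ i, |ν₀ i| < 1)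
    (hT : 1 ≤ T) (z : ℝ) :
    Tendsto (fun m => dilate ⟨fun x => (corrPoly m S T (ν m)).eval x, (corrPoly m S T (ν m)).continuous⟩ z)
      atTop (𝓝 0) := by
  have key : ∀ j k, Tendsto (fun m => corrCoeff m S T (ν m) j k •
      dilate ⟨fun x => (oddPoly S T (ν m) j k).eval x, (oddPoly S T (ν m) j k).continuous⟩ z)
      atTop (𝓝 ((0 : ℝ) •
        dilate ⟨fun x => (oddPoly S T ν₀ j k).eval x, (oddPoly S T ν₀ j k).continuous⟩ z)) := by
    intro j k
    refine (tendsto_corrCoeff S hν hinj hlt hT j k).smul ?_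
    have hc : Continuous fun ν : ι → ℝ => dilate
        ⟨fun x => (oddPoly S T ν j k).eval x, (oddPoly S T ν j k).continuous⟩ z := by
      refine ContinuousMap.continuous_of_continuous_uncurry _ ?_
      exact (isSmoothFamily_oddPoly S T j k 0).comp
        (f := fun x : (ι → ℝ) × I => (x.1, z * (x.2 : ℝ))) (by fun_prop)
    exact (hc.tendsto ν₀).comp hν
  have h := tendsto_finsetSum Finset.univ fun j _ =>
    tendsto_finsetSum (Finset.range S) fun k _ => key j k
  simp only [zero_smul, Finset.sum_const_zero] at h
  refine h.congr fun m => ?_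
  ext s
  simp [dilate_apply, corrPoly, eval_finsetSum, ContinuousMap.sum_apply]

end

end

end ShearFlow

namespace ShearFlow

noncomputable section

open scoped unitInterval

/-! ### The number of oscillations of the solution at energy zero -/

theorem volterraSol_const (κ : ℝ) (t : I) :
    volterraSol ((-κ ^ 2) • 1) t = Real.cos (κ * t) := by
  let u : C(I, ℝ) := ⟨fun t => Real.cos (κ * t), by fun_prop⟩
  have hu : u = volterraSol ((-κ ^ 2) • 1) := by
    refine eq_volterraSol ?_
    ext t
    rw [ContinuousMap.add_apply, volterra_apply]
    -- An explicit primitive of the integrand of the Volterra equation for `cos (κ s)`.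
    have hd : ∀ s : ℝ, HasDerivAt
        (fun s => Real.cos (κ * s) - (t - s) * (κ * Real.sin (κ * s)))
        ((t - s) * (-κ ^ 2 * Real.cos (κ * s))) s := fun s => by
      have h1 : HasDerivAt (fun s => κ * s) κ s := by simpa using (hasDerivAt_id s).const_mul κ
      refine (h1.cos.sub (((hasDerivAt_id s).const_sub (t : ℝ)).mul
        (h1.sin.const_mul κ))).congr_deriv ?_
      simp only [id]
      ring
    have h := intervalIntegral.integral_eq_sub_of_hasDerivAt (a := 0) (b := (t : ℝ))
      (fun s _ => hd s) (Continuous.intervalIntegrable (by fun_prop) _ _)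
    have h2 : ∫ s in (0 : ℝ)..t, ((t : ℝ) - s) * lineExtend ((-κ ^ 2) • 1 * u) s =
        ∫ s in (0 : ℝ)..t, ((t : ℝ) - s) * (-κ ^ 2 * Real.cos (κ * s)) := by
      refine intervalIntegral.integral_congr fun s hs => ?_
      rw [Set.uIcc_of_le t.2.1] at hs
      rw [lineExtend_of_mem _ ⟨hs.1, hs.2.trans t.2.2⟩]
      simp [u]
    rw [h2, h]
    simp [u]
  rw [← hu]
  rfl

/-- Each sign change of `ψ` costs a multiple of `π`: past `x k` the angle stays above `k π`, and if
it were still at most `(k + 1) π` at `x (k + 1)`, the sign of `ψ` there would be wrong. -/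
theorem nat_mul_pi_lt_theta {W : C(ℝ, ℝ)} (hW : ∀ z, AnalyticAt ℝ (dilate W) z) {x : ℕ → ℝ}
    (hx : StrictMono x) (hx0 : x 0 = 0) {N : ℕ}
    (hsign : ∀ k ≤ N, 0 < psi W (x k) 0 * (-1) ^ k) {k : ℕ} (hk : k ≤ N) :
    k * Real.pi < theta W (x k) 0 := by
  induction k with
  | zero => rw [hx0, theta_zero, Nat.cast_zero, zero_mul]; positivity
  | succ k ih =>
    have h1 := lt_theta_of_le hW k (hx (Nat.lt_succ_self k)) (ih (by omega)).le
    by_contra! h2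
    obtain ⟨ρ, hρ, hpsi, -⟩ := exists_prufer_radius hW (x (k + 1)) 0
    have h3 := hsign (k + 1) hk
    set θ := theta W (x (k + 1)) 0
    have h4 : Real.sin θ = (-1) ^ k * Real.sin (θ - k * Real.pi) := by
      rw [← Real.sin_add_nat_mul_pi, sub_add_cancel]
    have h5 : 0 ≤ Real.sin (θ - k * Real.pi) := by
      refine Real.sin_nonneg_of_nonneg_of_le_pi (by linarith) ?_
      push_cast at h2
      linarith
    have h6 : ((-1 : ℝ) ^ k) * (-1) ^ k = 1 := by
      rw [← mul_pow]; norm_num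
    rw [hpsi, h4, pow_succ] at h3
    have h7 : ρ * ((-1) ^ k * Real.sin (θ - k * Real.pi)) * ((-1) ^ k * -1) =
        -(ρ * Real.sin (θ - k * Real.pi)) := by
      linear_combination (-ρ * Real.sin (θ - k * Real.pi)) * h6
    rw [h7] at h3
    nlinarith

theorem signed_injective {κ₀ : ℕ} {y : Fin κ₀ → ℝ} (hpos : ∀ p, 0 < y p)
    (hinj : Function.Injective y) : Function.Injective (signed y) := by
  rintro (p | p) (q | q) h
  · exact congrArg _ (hinj h)
  · simp only [signed, Sum.elim_inl, Sum.elim_inr] at h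
    linarith [hpos p, hpos q]
  · simp only [signed, Sum.elim_inl, Sum.elim_inr] at h
    linarith [hpos p, hpos q]
  · simp only [signed, Sum.elim_inr, neg_inj] at h
    exact congrArg _ (hinj h)

theorem eventually_lt_theta_wellPotential {κ₀ : ℕ} (hκ₀ : 1 ≤ κ₀) (S : ℕ) {T : ℝ} (hT : 1 ≤ T)
    {node : ℕ → Fin κ₀ → ℝ} (hnode : ∀ p : Fin κ₀,
      Tendsto (fun m => node m p) atTop (𝓝 (((p : ℝ) + 1) / ((κ₀ : ℝ) + 1 / 4)))) :
    ∀ᶠ m in atTop, κ₀ * Real.pi < theta (wellPotential m S T (node m)) 1 0 := by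
  have hκpos : (0 : ℝ) < κ₀ := by exact_mod_cast hκ₀
  have hκ4 : (0 : ℝ) < (κ₀ : ℝ) + 1 / 4 := by positivity
  set y₀ : Fin κ₀ → ℝ := fun p => ((p : ℝ) + 1) / ((κ₀ : ℝ) + 1 / 4) with hy₀
  have hy₀pos : ∀ p, 0 < y₀ p := fun p => by positivity
  have hy₀lt : ∀ p, y₀ p < 1 := fun p => by
    rw [hy₀, div_lt_one hκ4]
    have : ((p : ℕ) : ℝ) + 1 ≤ κ₀ := by exact_mod_cast p.2
    linarith
  have hy₀inj : Function.Injective y₀ := fun p q h => by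
    simp only [hy₀] at h
    rw [div_left_inj' hκ4.ne'] at h
    exact Fin.ext (by exact_mod_cast add_right_cancel h)
  have hν : Tendsto (fun m => signed (node m)) atTop (𝓝 (signed y₀)) := by
    refine tendsto_pi_nhds.2 ?_
    rintro (p | p)
    · exact hnode p
    · exact (hnode p).neg
  have hlt : ∀ i, |signed y₀ i| < 1 := by
    rintro (p | p)
    · simpa [signed, abs_of_pos (hy₀pos p)] using hy₀lt p
    · simpa [signed, abs_of_pos (hy₀pos p)] using hy₀lt p
  -- Chosen so that `wellConst κ₀ * z₀ = κ₀ π`: the limit solution takes the values `(-1) ^ k` at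
  -- the points `z₀ k / κ₀`. As `z₀ < 1`, `h_m` tends to `1` uniformly on `[0, z₀]`.
  set z₀ : ℝ := κ₀ / ((κ₀ : ℝ) + 1 / 4) with hz₀
  have hz₀pos : 0 < z₀ := by positivity
  have hz₀lt : z₀ < 1 := by rw [hz₀, div_lt_one hκ4]; linarith
  have hcoeff : Tendsto (fun m => scaledCoeff (wellPotential m S T (node m)) z₀ 0) atTop
      (𝓝 ((-(κ₀ * Real.pi) ^ 2) • 1)) := by
    have h1 := (((tendsto_dilate_stepFun hz₀pos.le hz₀lt).add (tendsto_dilate_corrPoly S hν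
      (signed_injective hy₀pos hy₀inj) hlt hT z₀)).const_smul (wellConst κ₀ ^ 2)).const_smul
      (-z₀ ^ 2)
    have h2 : (-z₀ ^ 2) • wellConst κ₀ ^ 2 • ((1 : C(I, ℝ)) + 0) =
        (-(κ₀ * Real.pi) ^ 2) • 1 := by
      rw [add_zero, smul_smul]
      congr 1
      rw [hz₀, wellConst]
      field_simp
    rw [h2] at h1
    refine h1.congr fun m => ?_
    rw [scaledCoeff, zero_smul, add_zero, dilate_wellPotential]
    rfl
  have hsol := ((analyticAt_volterraSol _).continuousAt.tendsto).comp hcoeff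
  have hk : ∀ k ∈ Finset.range (κ₀ + 1), ∀ᶠ m in atTop,
      0 < psi (wellPotential m S T (node m)) (z₀ * (k / κ₀)) 0 * (-1) ^ k := by
    intro k hk
    have hk' : (k : ℝ) ≤ κ₀ := by exact_mod_cast Nat.lt_succ_iff.1 (Finset.mem_range.1 hk)
    set t : I := ⟨k / κ₀, by positivity, (div_le_one hκpos).2 hk'⟩
    have h1 := (((continuous_eval_const t).tendsto _).comp hsol).mul_const ((-1 : ℝ) ^ k)
    rw [volterraSol_const] at h1
    have h2 : (κ₀ * Real.pi) * (t : ℝ) = k * Real.pi := by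
      change κ₀ * Real.pi * (k / κ₀) = _
      field_simp
    rw [h2, Real.cos_nat_mul_pi, ← mul_pow] at h1
    refine (h1.eventually (lt_mem_nhds (by norm_num : (0 : ℝ) < _))).mono fun m hm => ?_
    simp only [Function.comp_apply, volterraSol_scaledCoeff] at hm
    exact hm
  refine ((Filter.eventually_all_finset _).2 hk).mono fun m hm => ?_
  have hW := analyticAt_dilate_wellPotential m S T (node m)
  have h1 := nat_mul_pi_lt_theta hW (x := fun k => z₀ * (k / κ₀)) (N := κ₀)
    (fun k k' h => by
      have : (k : ℝ) < k' := by exact_mod_cast h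
      simp only
      gcongr) (by simp) (fun k hk => hm k (Finset.mem_range.2 (Nat.lt_succ_of_le hk))) le_rfl
  rw [div_self hκpos.ne', mul_one] at h1
  exact lt_theta_of_le hW κ₀ hz₀lt h1.le

end

end ShearFlow

namespace ShearFlow

noncomputable section

/-! ### Sublevel sets of functions with a large derivative -/

/-- Greedy choice: take a point almost at the infimum and discard everything up to distance `d`
beyond it. This costs barely more than `d` of measure, and the slack `η` in the hypothesis pays for
the excess. -/
theorem exists_separated_of_lt_volume {s : Set ℝ} {α d : ℝ} (hs : s ⊆ Set.Ici α) (hd : 0 < d)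
    (k : ℕ) (h : ENNReal.ofReal (k * d) < volume s) :
    ∃ x : ℕ → ℝ, (∀ i ≤ k, x i ∈ s) ∧ ∀ i < k, x i + d ≤ x (i + 1) := by
  induction k generalizing s α with
  | zero =>
    obtain ⟨x, hx⟩ : s.Nonempty := by
      rw [Set.nonempty_iff_ne_empty]
      rintro rfl
      simp at h
    exact ⟨fun _ => x, fun i _ => hx, fun i hi => absurd hi (Nat.not_lt_zero i)⟩
  | succ k ih =>
    have hne : s.Nonempty := by
      rw [Set.nonempty_iff_ne_empty]
      rintro rfl
      simp at h
    have hbdd : BddBelow s := ⟨α, hs⟩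
    obtain ⟨c, hc1, hc2⟩ := exists_between h
    have hctop : c ≠ ⊤ := ne_top_of_lt hc2
    have hc1' : ((k + 1 : ℕ) : ℝ) * d < c.toReal := (ENNReal.ofReal_lt_iff_lt_toReal
      (by positivity) hctop).1 hc1
    set η := c.toReal - ((k + 1 : ℕ) : ℝ) * d with hη
    have hηpos : 0 < η := sub_pos.2 hc1'
    obtain ⟨x₀, hx₀, hx₀lt⟩ := Real.lt_sInf_add_pos hne hηpos
    have hvol : ENNReal.ofReal (k * d) < volume (s ∩ Set.Ici (x₀ + d)) := by
      by_contra! hle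
      have hcover : s ⊆ Set.Icc (sInf s) (x₀ + d) ∪ (s ∩ Set.Ici (x₀ + d)) := fun y hy => by
        rcases le_total y (x₀ + d) with h | h
        · exact Or.inl ⟨csInf_le hbdd hy, h⟩
        · exact Or.inr ⟨hy, h⟩
      have h2 : volume s ≤ ENNReal.ofReal (x₀ + d - sInf s) + ENNReal.ofReal (k * d) :=
        (measure_mono hcover).trans ((measure_union_le _ _).trans
          (add_le_add (by rw [Real.volume_Icc]) hle))
      rw [← ENNReal.ofReal_add (by linarith [csInf_le hbdd hx₀]) (by positivity)] at h2
      refine absurd (hc2.trans_le h2) (not_lt.2 ?_)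
      rw [← ENNReal.ofReal_toReal hctop]
      refine ENNReal.ofReal_le_ofReal ?_
      push_cast at hη
      linarith
    obtain ⟨x, hx, hxd⟩ := ih (s := s ∩ Set.Ici (x₀ + d)) (α := x₀ + d)
      Set.inter_subset_right hvol
    refine ⟨fun i => Nat.casesOn i x₀ x, ?_, ?_⟩
    · rintro (_ | i) hi
      · exact hx₀
      · exact (hx i (by omega)).1
    · rintro (_ | i) hi
      · exact (hx 0 (Nat.zero_le _)).2
      · exact hxd i (by omega)

/-- If a function is at most `ε` in absolute value at `2 ^ n` points that are `d`-separated, then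
its derivative of order `n` is at most `(2 / d) ^ n ε` somewhere. -/
theorem exists_abs_deriv_le_of_separated {α β d : ℝ} (hd : 0 < d) (n : ℕ) {F : ℕ → ℝ → ℝ} {ε : ℝ}
    (hF : ∀ k, ∀ x ∈ Set.Icc α β, HasDerivAt (F k) (F (k + 1) x) x) {x : ℕ → ℝ}
    (hx : ∀ i < 2 ^ n, x i ∈ Set.Icc α β ∧ |F 0 (x i)| ≤ ε)
    (hxd : ∀ i, i + 1 < 2 ^ n → x i + d ≤ x (i + 1)) :
    ∃ y ∈ Set.Icc α β, |F n y| ≤ (2 / d) ^ n * ε := by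
  induction n generalizing F ε x with
  | zero => exact ⟨x 0, (hx 0 (by norm_num)).1, by simpa using (hx 0 (by norm_num)).2⟩
  | succ n ih =>
    -- The points are paired and the mean value theorem is applied within each pair. The unused gap
    -- between consecutive pairs keeps the new points `d`-separated.
    have hy : ∀ i, ∃ y, i < 2 ^ n → y ∈ Set.Ioo (x (2 * i)) (x (2 * i + 1)) ∧
        |F 1 y| ≤ 2 / d * ε := fun i => by
      by_cases hi : i < 2 ^ n
      · have h1 : 2 * i + 1 < 2 ^ (n + 1) := by rw [pow_succ]; omega
        have ha := hx (2 * i) (by omega)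
        have hb := hx (2 * i + 1) h1
        have hsep := hxd (2 * i) h1
        have hsub : ∀ t ∈ Set.Icc (x (2 * i)) (x (2 * i + 1)), t ∈ Set.Icc α β := fun t ht =>
          ⟨ha.1.1.trans ht.1, ht.2.trans hb.1.2⟩
        obtain ⟨y, hy, hyd⟩ := exists_hasDerivAt_eq_slope (F 0) (F 1)
          (show x (2 * i) < x (2 * i + 1) by linarith)
          (fun t ht => (hF 0 t (hsub t ht)).continuousAt.continuousWithinAt)
          (fun t ht => hF 0 t (hsub t ⟨ht.1.le, ht.2.le⟩))
        refine ⟨y, fun _ => ⟨hy, ?_⟩⟩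
        have hpos : 0 < x (2 * i + 1) - x (2 * i) := by linarith
        have h4 : |F 0 (x (2 * i + 1)) - F 0 (x (2 * i))| ≤ 2 * ε :=
          (abs_sub _ _).trans (by linarith [ha.2, hb.2])
        have hε : 0 ≤ ε := (abs_nonneg _).trans ha.2
        rw [hyd, abs_div, abs_of_pos hpos, div_le_iff₀ hpos]
        refine h4.trans ?_
        calc 2 * ε = 2 / d * ε * d := by field_simp
          _ ≤ _ := mul_le_mul_of_nonneg_left (by linarith) (by positivity)
      · exact ⟨0, fun h => absurd h hi⟩
    choose y hy using hy
    have hmem : ∀ i < 2 ^ n, y i ∈ Set.Icc α β := fun i hi => by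
      have h1 : 2 * i + 1 < 2 ^ (n + 1) := by rw [pow_succ]; omega
      exact ⟨(hx (2 * i) (by omega)).1.1.trans (hy i hi).1.1.le,
        (hy i hi).1.2.le.trans (hx (2 * i + 1) h1).1.2⟩
    obtain ⟨z, hz, hzle⟩ := ih (F := fun k => F (k + 1)) (ε := 2 / d * ε) (x := y)
      (fun k t ht => hF (k + 1) t ht) (fun i hi => ⟨hmem i hi, (hy i hi).2⟩) (fun i hi => by
        have h1 : 2 * i + 1 + 1 < 2 ^ (n + 1) := by rw [pow_succ]; omega
        have h2 := hxd (2 * i + 1) h1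
        have h3 := (hy i (by omega)).1.2
        have h4 := (hy (i + 1) hi).1.1
        rw [show 2 * (i + 1) = 2 * i + 1 + 1 by ring] at h4
        linarith)
    exact ⟨z, hz, hzle.trans (le_of_eq (by ring))⟩

theorem volume_sublevel_le {α β d b ε : ℝ} (hd : 0 < d) (n : ℕ) {F : ℕ → ℝ → ℝ}
    (hF : ∀ k, ∀ x ∈ Set.Icc α β, HasDerivAt (F k) (F (k + 1) x) x)
    (hb : ∀ x ∈ Set.Icc α β, b ≤ |F n x|) (hε : (2 / d) ^ n * ε < b) :
    volume {x ∈ Set.Icc α β | |F 0 x| ≤ ε} ≤ ENNReal.ofReal (2 ^ n * d) := by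
  by_contra! h
  obtain ⟨x, hx, hxd⟩ := exists_separated_of_lt_volume (s := {x ∈ Set.Icc α β | |F 0 x| ≤ ε})
    (fun x hx => hx.1.1) hd (2 ^ n) (by push_cast; exact h)
  obtain ⟨y, hy, hle⟩ := exists_abs_deriv_le_of_separated hd n hF (fun i hi => hx i hi.le)
    (fun i hi => hxd i (by omega))
  linarith [hb y hy]

/-! ### Integer vectors -/

theorem one_le_bracket {d : ℕ} (ℓ : Fin d → ℤ) : 1 ≤ bracket ℓ := le_max_left _ _

theorem abs_le_bracket {d : ℕ} (ℓ : Fin d → ℤ) (i : Fin d) : |(ℓ i : ℝ)| ≤ bracket ℓ := by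
  refine le_trans ?_ (le_max_right _ _)
  rw [← Real.sqrt_sq_eq_abs]
  exact Real.sqrt_le_sqrt (Finset.single_le_sum (f := fun i => (ℓ i : ℝ) ^ 2)
    (fun i _ => sq_nonneg _) (Finset.mem_univ i))

theorem one_le_sum_sq {d : ℕ} {ℓ : Fin d → ℤ} (hℓ : ℓ ≠ 0) : (1 : ℝ) ≤ ∑ i, (ℓ i : ℝ) ^ 2 := by
  obtain ⟨i, hi⟩ := Function.ne_iff.1 hℓ
  have h1 : (1 : ℤ) ≤ ℓ i ^ 2 := by
    have : ℓ i ≠ 0 := hi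
    have : 0 < ℓ i ^ 2 := by positivity
    omega
  have h2 : (1 : ℝ) ≤ (ℓ i : ℝ) ^ 2 := by exact_mod_cast h1
  exact h2.trans (Finset.single_le_sum (f := fun i => (ℓ i : ℝ) ^ 2)
    (fun i _ => sq_nonneg _) (Finset.mem_univ i))

theorem bracket_eq {d : ℕ} {ℓ : Fin d → ℤ} (hℓ : ℓ ≠ 0) :
    bracket ℓ = √(∑ i, (ℓ i : ℝ) ^ 2) :=
  max_eq_right (Real.one_le_sqrt.2 (one_le_sum_sq hℓ))

theorem summable_norm_rpow_neg {d : ℕ} {s : ℝ} (hs : (d : ℝ) < s) :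
    Summable fun ℓ : Fin d → ℤ => ‖ℓ‖ ^ (-s) := by
  let L : Submodule ℤ (Fin d → ℝ) := Submodule.span ℤ (Set.range (Pi.basisFun ℝ (Fin d)))
  have hrank : Module.finrank ℤ L = d := by
    rw [ZLattice.rank ℝ L]
    simp
  have h := ZLattice.summable_norm_rpow L (-s) (by rw [hrank]; linarith)
  have hmem : ∀ ℓ : Fin d → ℤ, (fun i => (ℓ i : ℝ)) ∈ L := fun ℓ => by
    refine ((Pi.basisFun ℝ (Fin d)).mem_span_iff_repr_mem ℤ _).2 fun i => ?_
    exact ⟨ℓ i, by simp⟩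
  have hinj : Function.Injective fun ℓ : Fin d → ℤ => (⟨fun i => (ℓ i : ℝ), hmem ℓ⟩ : L) := by
    intro ℓ ℓ' h
    funext i
    have h' : (ℓ i : ℝ) = ℓ' i := congrFun (congrArg Subtype.val h) i
    exact_mod_cast h'
  refine (h.comp_injective hinj).congr fun ℓ => ?_
  simp only [Function.comp_apply]
  congr 1

theorem norm_le_bracket {d : ℕ} (ℓ : Fin d → ℤ) : ‖ℓ‖ ≤ bracket ℓ :=
  (pi_norm_le_iff_of_nonneg (zero_le_one.trans (one_le_bracket ℓ))).2 fun i => by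
    rw [Int.norm_eq_abs]
    exact abs_le_bracket ℓ i

theorem bracket_rpow_neg_le {d : ℕ} {ℓ : Fin d → ℤ} (hℓ : ℓ ≠ 0) {s : ℝ} (hs : 0 ≤ s) :
    bracket ℓ ^ (-s) ≤ ‖ℓ‖ ^ (-s) :=
  Real.rpow_le_rpow_of_nonpos (norm_pos_iff.2 hℓ) (norm_le_bracket ℓ) (by linarith)

end

end ShearFlow

namespace ShearFlow

noncomputable section

/-! ### Derivatives of the divisors `w · ℓ` -/

/-- The derivative of order `n` of `w · c`. -/
def pairingDeriv {d : ℕ} (w : ℝ → Fin d → ℝ) (n : ℕ) (E : ℝ) (c : Fin d → ℝ) : ℝ :=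
  ∑ i, iteratedDeriv n (fun E => w E i) E * c i

theorem hasDerivAt_iteratedDeriv {f : ℝ → ℝ} {x : ℝ} (hf : AnalyticAt ℝ f x) (n : ℕ) :
    HasDerivAt (iteratedDeriv n f) (iteratedDeriv (n + 1) f x) x := by
  rw [iteratedDeriv_succ, iteratedDeriv_eq_iterate]
  exact (hf.iterated_deriv n).differentiableAt.hasDerivAt

theorem hasDerivAt_pairingDeriv {d : ℕ} {w : ℝ → Fin d → ℝ} {E : ℝ}
    (hw : ∀ i, AnalyticAt ℝ (fun E => w E i) E) (c : Fin d → ℝ) (n : ℕ) :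
    HasDerivAt (fun E => pairingDeriv w n E c) (pairingDeriv w (n + 1) E c) E :=
  HasDerivAt.fun_sum fun i _ => (hasDerivAt_iteratedDeriv (hw i) n).mul_const (c i)

theorem pairingDeriv_zero_intCast {d : ℕ} (w : ℝ → Fin d → ℝ) (E : ℝ) (ℓ : Fin d → ℤ) :
    pairingDeriv w 0 E (fun i => (ℓ i : ℝ)) = pairing (w E) ℓ := by
  simp [pairing, pairingDeriv]

theorem iteratedDerivWithin_pairing {d : ℕ} {w : ℝ → Fin d → ℝ} {E₁ E₂ : ℝ}
    (hw : ∀ E ∈ Set.Icc E₁ E₂, ∀ i, AnalyticAt ℝ (fun E => w E i) E)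
    (h12 : E₁ < E₂) (ℓ : Fin d → ℤ) (n : ℕ) {E : ℝ} (hE : E ∈ Set.Icc E₁ E₂) :
    iteratedDerivWithin n (fun E' => pairing (w E') ℓ) (Set.Icc E₁ E₂) E =
      pairingDeriv w n E fun i => (ℓ i : ℝ) := by
  induction n generalizing E with
  | zero => rw [iteratedDerivWithin_zero, pairingDeriv_zero_intCast]
  | succ n ih =>
    rw [iteratedDerivWithin_succ]
    have h := (hasDerivAt_pairingDeriv (hw E hE) (fun i => (ℓ i : ℝ)) n).hasDerivWithinAt
      (s := Set.Icc E₁ E₂)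
    exact (h.congr (fun x hx => ih hx) (ih hE)).derivWithin (uniqueDiffOn_Icc h12 E hE)

theorem iteratedDeriv_sum_mul {d : ℕ} {w : ℝ → Fin d → ℝ} {E : ℝ}
    (hw : ∀ i, AnalyticAt ℝ (fun E => w E i) E) (c : Fin d → ℝ) (n : ℕ) :
    iteratedDeriv n (fun E => ∑ i, w E i * c i) E = pairingDeriv w n E c := by
  have hev : ∀ᶠ x in 𝓝 E, ∀ i, AnalyticAt ℝ (fun E => w E i) x :=
    Filter.eventually_all.2 fun i => (hw i).eventually_analyticAt
  have key : iteratedDeriv n (fun E => ∑ i, w E i * c i) =ᶠ[𝓝 E]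
      fun E => pairingDeriv w n E c := by
    induction n with
    | zero => exact Eventually.of_forall fun x => by simp [pairingDeriv]
    | succ n ih =>
      rw [iteratedDeriv_succ]
      filter_upwards [ih.eventuallyEq_nhds, hev] with x hx hwx
      rw [hx.deriv_eq]
      exact (hasDerivAt_pairingDeriv hwx c n).deriv
  exact key.self_of_nhds

/-! ### Existence of an index of non-degeneracy -/

theorem IsNondegIndex.mono {d : ℕ} {w : ℝ → Fin d → ℝ} {E₁ E₂ : ℝ} {M m₀ : ℕ}
    (h : IsNondegIndex w E₁ E₂ M) (hle : M ≤ m₀) : IsNondegIndex w E₁ E₂ m₀ := by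
  obtain ⟨ρ, hρ, h⟩ := h
  refine ⟨ρ, hρ, fun E hE ℓ hℓ => ?_⟩
  obtain ⟨n, hn, hle'⟩ := h E hE ℓ hℓ
  exact ⟨n, hn.trans hle, hle'⟩

/-- If all derivatives of `w · c` vanished at `E`, its Taylor series would be zero and `w · c` would
vanish nearby. So some derivative is nonzero near each `(E, c)`; compactness of `[E₁, E₂]` times the
Euclidean unit sphere bounds the order, and homogeneity in `c` restores the factor `⟨ℓ⟩`. -/
theorem exists_isNondegIndex {d : ℕ} {w : ℝ → Fin d → ℝ} {E₁ E₂ : ℝ} (h12 : E₁ < E₂)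
    (hw : ∀ E ∈ Set.Icc E₁ E₂, ∀ i, AnalyticAt ℝ (fun E => w E i) E)
    (hind : ∀ E ∈ Set.Icc E₁ E₂, ∀ c : Fin d → ℝ, c ≠ 0 →
      ¬ ∀ᶠ x in 𝓝 E, ∑ i, w x i * c i = 0) :
    ∃ M, IsNondegIndex w E₁ E₂ M := by
  set sph : Set (Fin d → ℝ) := {c | ∑ i, c i ^ 2 = 1} with hsph
  have hsphc : IsCompact sph := by
    refine Metric.isCompact_of_isClosed_isBounded
      (isClosed_eq (by fun_prop) continuous_const) ?_
    refine (Metric.isBounded_closedBall (x := (0 : Fin d → ℝ)) (r := 1)).subset fun c hc => ?_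
    rw [mem_closedBall_zero_iff, pi_norm_le_iff_of_nonneg zero_le_one]
    intro i
    rw [Real.norm_eq_abs, ← sq_le_one_iff_abs_le_one]
    exact (Finset.single_le_sum (f := fun i => c i ^ 2) (fun i _ => sq_nonneg _)
      (Finset.mem_univ i)).trans hc.le
  have hcont : ∀ n, ContinuousOn (fun p : ℝ × (Fin d → ℝ) => pairingDeriv w n p.1 p.2)
      (Set.Icc E₁ E₂ ×ˢ sph) := fun n p hp => by
    refine tendsto_finsetSum _ fun i _ => ?_
    have h1 : ContinuousAt (fun p : ℝ × (Fin d → ℝ) => iteratedDeriv n (fun E => w E i) p.1) p :=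
      (hasDerivAt_iteratedDeriv (hw p.1 hp.1 i) n).continuousAt.comp' continuousAt_fst
    exact (h1.mul (by fun_prop)).continuousWithinAt
  obtain ⟨M, ρ, hρ, hM⟩ : ∃ M : ℕ, ∃ ρ > 0, ∀ p ∈ Set.Icc E₁ E₂ ×ˢ sph, ∃ n ≤ M,
      ρ ≤ |pairingDeriv w n p.1 p.2| := by
    refine (isCompact_Icc.prod hsphc).induction_on (p := fun s => ∃ M : ℕ, ∃ ρ > 0, ∀ p ∈ s,
      ∃ n ≤ M, ρ ≤ |pairingDeriv w n p.1 p.2|) ⟨0, 1, one_pos, by simp⟩ ?_ ?_ ?_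
    · rintro s t hst ⟨M, ρ, hρ, h⟩
      exact ⟨M, ρ, hρ, fun p hp => h p (hst hp)⟩
    · rintro s t ⟨M, ρ, hρ, h⟩ ⟨M', ρ', hρ', h'⟩
      refine ⟨max M M', min ρ ρ', lt_min hρ hρ', ?_⟩
      rintro p (hp | hp)
      · obtain ⟨n, hn, hle⟩ := h p hp
        exact ⟨n, hn.trans (le_max_left _ _), (min_le_left _ _).trans hle⟩
      · obtain ⟨n, hn, hle⟩ := h' p hp
        exact ⟨n, hn.trans (le_max_right _ _), (min_le_right _ _).trans hle⟩
    · rintro ⟨E, c⟩ hp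
      have hc : c ≠ 0 := by
        rintro rfl
        simpa [hsph] using hp.2
      obtain ⟨n, hn⟩ : ∃ n, pairingDeriv w n E c ≠ 0 := by
        by_contra! hall
        refine hind E hp.1 c hc ?_
        have han : AnalyticAt ℝ (fun x => ∑ i, w x i * c i) E :=
          Finset.analyticAt_fun_sum _ fun i _ => (hw E hp.1 i).mul analyticAt_const
        have hser := han.hasFPowerSeriesAt
        simp only [iteratedDeriv_sum_mul (hw E hp.1), hall, zero_div] at hser
        have hzero : FormalMultilinearSeries.ofScalars ℝ (fun _ : ℕ => (0 : ℝ)) =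
            (0 : FormalMultilinearSeries ℝ ℝ ℝ) := by
          funext n
          simp [FormalMultilinearSeries.ofScalars]
        rw [hzero] at hser
        exact hser.eventually_eq_zero
      have hpos := abs_pos.2 hn
      refine ⟨{p | |pairingDeriv w n E c| / 2 < |pairingDeriv w n p.1 p.2|},
        ((hcont n _ hp).abs.eventually (lt_mem_nhds (half_lt_self hpos))), n, _, half_pos hpos,
        fun p hp => ⟨n, le_rfl, le_of_lt hp⟩⟩
  refine ⟨M, ρ, hρ, fun E hE ℓ hℓ => ?_⟩
  set r := √(∑ i, (ℓ i : ℝ) ^ 2) with hr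
  have hsum := one_le_sum_sq hℓ
  have hr2 : r ^ 2 = ∑ i, (ℓ i : ℝ) ^ 2 := Real.sq_sqrt (by linarith)
  have hr1 : 1 ≤ r := Real.one_le_sqrt.2 hsum
  have hr0 : r ≠ 0 := by linarith
  obtain ⟨n, hn, hle⟩ := hM (E, fun i => (ℓ i : ℝ) / r) ⟨hE, by
    simp only [hsph, Set.mem_ofPred_eq, div_pow]
    rw [← Finset.sum_div, ← hr2]
    field_simp⟩
  refine ⟨n, hn, ?_⟩
  rw [iteratedDerivWithin_pairing hw h12 ℓ n hE, bracket_eq hℓ, ← hr]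
  have h1 : pairingDeriv w n E (fun i => (ℓ i : ℝ)) =
      pairingDeriv w n E (fun i => (ℓ i : ℝ) / r) * r := by
    simp only [pairingDeriv, Finset.sum_mul]
    refine Finset.sum_congr rfl fun i _ => ?_
    field_simp
  rw [h1, abs_mul, abs_of_pos (by linarith : 0 < r)]
  exact mul_le_mul_of_nonneg_right hle (by linarith)

/-! ### The measure of the set of resonant parameters -/

theorem measurableSet_diophantineSet {d : ℕ} {w : ℝ → Fin d → ℝ} {E₁ E₂ : ℝ}
    (hw : ∀ i, ContinuousOn (fun E => w E i) (Set.Icc E₁ E₂)) (υ τ : ℝ) :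
    MeasurableSet (diophantineSet w E₁ E₂ υ τ) := by
  have h : diophantineSet w E₁ E₂ υ τ = Set.Icc E₁ E₂ ∩ ⋂ (ℓ : Fin d → ℤ) (_ : ℓ ≠ 0),
      {E ∈ Set.Icc E₁ E₂ | υ * bracket ℓ ^ (-τ) ≤ |pairing (w E) ℓ|} := by
    ext E
    simp only [diophantineSet, IsDiophantine, Set.mem_inter_iff, Set.mem_iInter, Set.mem_ofPred_eq]
    exact ⟨fun h => ⟨h.1, fun ℓ hℓ => ⟨h.1, h.2 ℓ hℓ⟩⟩, fun h => ⟨h.1, fun ℓ hℓ => (h.2 ℓ hℓ).2⟩⟩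
  rw [h]
  refine measurableSet_Icc.inter (MeasurableSet.iInter fun ℓ => MeasurableSet.iInter fun _ => ?_)
  have hc : ContinuousOn (fun E => |pairing (w E) ℓ|) (Set.Icc E₁ E₂) :=
    (continuousOn_finsetSum _ fun i _ => (hw i).mul continuousOn_const).abs
  exact (hc.preimage_isClosed_of_isClosed isClosed_Icc isClosed_Ici).measurableSet

/-- The sublevel sets of a divisor have measure of order `(ε / ⟨ℓ⟩) ^ (1 / m₀)`; here
`ε = ρ₀ ⟨ℓ⟩ y ^ m₀ / 2`. -/
theorem exists_volume_pairing_le {d : ℕ} {w : ℝ → Fin d → ℝ} {E₁ E₂ : ℝ} (h12 : E₁ < E₂)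
    (hw : ∀ E ∈ Set.Icc E₁ E₂, ∀ i, AnalyticAt ℝ (fun E => w E i) E) {m₀ : ℕ} (hm₀ : 1 ≤ m₀)
    {ρ₀ : ℝ} (hρ₀ : 0 < ρ₀) (hdeg : ∀ E ∈ Set.Icc E₁ E₂, ∀ ℓ : Fin d → ℤ, ℓ ≠ 0 →
      ∃ n ≤ m₀, ρ₀ * bracket ℓ ≤ |pairingDeriv w n E fun i => (ℓ i : ℝ)|) :
    ∃ K, 0 ≤ K ∧ ∀ ℓ : Fin d → ℤ, ℓ ≠ 0 → ∀ y > 0,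
      volume {E ∈ Set.Icc E₁ E₂ | |pairing (w E) ℓ| ≤ ρ₀ * bracket ℓ / 2 * y ^ m₀} ≤
        ENNReal.ofReal (K * y) := by
  have hbd : ∀ n i, ∃ K, ∀ E ∈ Set.Icc E₁ E₂, |iteratedDeriv n (fun E => w E i) E| ≤ K :=
    fun n i => isCompact_Icc.exists_bound_of_continuousOn fun E hE =>
      (hasDerivAt_iteratedDeriv (hw E hE i) n).continuousAt.continuousWithinAt
  choose B hB using hbd
  -- Orders up to `m₀ + 1` are needed: the derivative of order `n ≤ m₀` is kept large by bounding
  -- the next one.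
  set A : ℝ := ∑ n ∈ Finset.range (m₀ + 2), ∑ i, |B n i| with hA
  have hA0 : 0 ≤ A := Finset.sum_nonneg fun _ _ => Finset.sum_nonneg fun _ _ => abs_nonneg _
  have hAle : ∀ n ≤ m₀ + 1, ∀ E ∈ Set.Icc E₁ E₂, ∀ ℓ : Fin d → ℤ,
      |pairingDeriv w n E fun i => (ℓ i : ℝ)| ≤ A * bracket ℓ := fun n hn E hE ℓ => by
    calc |pairingDeriv w n E fun i => (ℓ i : ℝ)| ≤ ∑ i, |B n i| * bracket ℓ := by
          refine (Finset.abs_sum_le_sum_abs _ _).trans (Finset.sum_le_sum fun i _ => ?_)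
          rw [abs_mul]
          exact mul_le_mul ((hB n i E hE).trans (le_abs_self _)) (abs_le_bracket ℓ i)
            (abs_nonneg _) (abs_nonneg _)
      _ = (∑ i, |B n i|) * bracket ℓ := by rw [Finset.sum_mul]
      _ ≤ A * bracket ℓ := by
        refine mul_le_mul_of_nonneg_right ?_ (zero_le_one.trans (one_le_bracket ℓ))
        exact Finset.single_le_sum (f := fun n => ∑ i, |B n i|)
          (fun _ _ => Finset.sum_nonneg fun _ _ => abs_nonneg _)
          (Finset.mem_range.2 (by omega))
  -- Over a length `δ`, independent of `ℓ`, a derivative of order at most `m₀` moves by at most `ρ₀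
  -- ⟨ℓ⟩ / 2`; so one order `n` serves on each of the `N` pieces.
  set δ : ℝ := ρ₀ / (2 * (A + 1)) with hδ
  have hδ0 : 0 < δ := by positivity
  have hAδ : A * δ ≤ ρ₀ / 2 := by
    rw [hδ]
    have : A / (A + 1) ≤ 1 := (div_le_one (by linarith)).2 (by linarith)
    calc A * (ρ₀ / (2 * (A + 1))) = ρ₀ / 2 * (A / (A + 1)) := by field_simp
      _ ≤ ρ₀ / 2 * 1 := mul_le_mul_of_nonneg_left this (by linarith)
      _ = _ := mul_one _
  set N : ℕ := ⌊(E₂ - E₁) / δ⌋₊ + 1 with hN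
  refine ⟨N * (2 ^ m₀ * 3) + (E₂ - E₁), by have := sub_pos.2 h12; positivity, fun ℓ hℓ y hy => ?_⟩
  have hℓ1 := one_le_bracket ℓ
  rcases le_or_gt 1 y with hy1 | hy1
  · refine (measure_mono (t := Set.Icc E₁ E₂) fun E hE => hE.1).trans ?_
    rw [Real.volume_Icc]
    refine ENNReal.ofReal_le_ofReal ?_
    have h1 := sub_pos.2 h12
    have h2 : 0 ≤ N * (2 ^ m₀ * 3) * y := by positivity
    nlinarith
  · set s := {E ∈ Set.Icc E₁ E₂ | |pairing (w E) ℓ| ≤ ρ₀ * bracket ℓ / 2 * y ^ m₀} with hs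
    set J : ℕ → Set ℝ := fun k => {E ∈ Set.Icc (E₁ + k * δ) (min (E₁ + (k + 1) * δ) E₂) |
      |pairingDeriv w 0 E fun i => (ℓ i : ℝ)| ≤ ρ₀ * bracket ℓ / 2 * y ^ m₀} with hJ
    have hcover : s ⊆ ⋃ k ∈ Finset.range N, J k := fun E hE => by
      have hE0 : 0 ≤ (E - E₁) / δ := div_nonneg (by linarith [hE.1.1]) hδ0.le
      refine Set.mem_biUnion (x := ⌊(E - E₁) / δ⌋₊) ?_ ⟨⟨?_, le_min ?_ hE.1.2⟩, ?_⟩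
      · simp only [Finset.coe_range, Set.mem_Iio, hN, Nat.lt_succ_iff]
        refine Nat.floor_le_floor ?_
        gcongr
        exact hE.1.2
      · have := Nat.floor_le hE0
        rw [le_div_iff₀ hδ0] at this
        linarith
      · have := (Nat.lt_floor_add_one ((E - E₁) / δ)).le
        rw [div_le_iff₀ hδ0] at this
        linarith
      · rw [pairingDeriv_zero_intCast]
        exact hE.2
    have hJle : ∀ k, volume (J k) ≤ ENNReal.ofReal (2 ^ m₀ * (3 * y)) := fun k => by
      rcases lt_or_ge E₂ (E₁ + k * δ) with hlt | hge
      · have : J k = ∅ := by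
          refine Set.eq_empty_of_forall_notMem fun E hE => ?_
          linarith [hE.1.1, hE.1.2.trans (min_le_right _ _)]
        rw [this, measure_empty]
        exact zero_le
      have hsub : ∀ x ∈ Set.Icc (E₁ + k * δ) (min (E₁ + (k + 1) * δ) E₂), x ∈ Set.Icc E₁ E₂ :=
        fun x hx => ⟨le_trans (by have : 0 ≤ k * δ := by positivity
                                  linarith) hx.1, hx.2.trans (min_le_right _ _)⟩
      have hleft : E₁ + k * δ ∈ Set.Icc (E₁ + k * δ) (min (E₁ + (k + 1) * δ) E₂) :=
        ⟨le_rfl, le_min (by linarith) hge⟩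
      obtain ⟨n, hn, hle⟩ := hdeg _ (hsub _ hleft) ℓ hℓ
      have hlow : ∀ x ∈ Set.Icc (E₁ + k * δ) (min (E₁ + (k + 1) * δ) E₂),
          ρ₀ * bracket ℓ / 2 ≤ |pairingDeriv w n x fun i => (ℓ i : ℝ)| := fun x hx => by
        have h1 := (convex_Icc (E₁ + k * δ) (min (E₁ + (k + 1) * δ) E₂)
          ).norm_image_sub_le_of_norm_hasDerivWithin_le
          (f := fun E => pairingDeriv w n E fun i => (ℓ i : ℝ)) (C := A * bracket ℓ)
          (fun x hx => (hasDerivAt_pairingDeriv (hw x (hsub x hx)) _ n).hasDerivWithinAt)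
          (fun x hx => hAle (n + 1) (by omega) x (hsub x hx) ℓ) hleft hx
        have h2 : ‖x - (E₁ + k * δ)‖ ≤ δ := by
          rw [Real.norm_eq_abs, abs_of_nonneg (by linarith [hx.1])]
          linarith [hx.2.trans (min_le_left _ _)]
        have h3 : A * bracket ℓ * ‖x - (E₁ + k * δ)‖ ≤ ρ₀ / 2 * bracket ℓ := by
          calc A * bracket ℓ * ‖x - (E₁ + k * δ)‖ ≤ A * bracket ℓ * δ :=
                mul_le_mul_of_nonneg_left h2 (by positivity)
            _ = A * δ * bracket ℓ := by ring
            _ ≤ _ := mul_le_mul_of_nonneg_right hAδ (by linarith)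
        have h4 := abs_sub_abs_le_abs_sub
          (pairingDeriv w n (E₁ + k * δ) fun i => (ℓ i : ℝ)) (pairingDeriv w n x fun i => (ℓ i : ℝ))
        rw [abs_sub_comm] at h4
        have h5 := h4.trans (h1.trans h3)
        linarith
      -- Separation `3 y` instead of `2 y` makes the inequality strict when `n ≥ 1`; for `n = 0`
      -- strictness comes from `y < 1` and `m₀ ≥ 1`.
      have hpow : (2 / (3 * y)) ^ n * (ρ₀ * bracket ℓ / 2 * y ^ m₀) < ρ₀ * bracket ℓ / 2 := by
        have hb : 0 < ρ₀ * bracket ℓ / 2 := by positivity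
        have e : (2 / (3 * y)) ^ n * (ρ₀ * bracket ℓ / 2 * y ^ m₀) =
            (2 / 3) ^ n * y ^ (m₀ - n) * (ρ₀ * bracket ℓ / 2) := by
          rw [← Nat.sub_add_cancel hn, pow_add, Nat.add_sub_cancel, div_pow, mul_pow, div_pow]
          field_simp
        rw [e]
        refine mul_lt_of_lt_one_left hb ?_
        rcases Nat.eq_zero_or_pos n with rfl | hn0
        · rw [pow_zero, one_mul]
          exact pow_lt_one₀ hy.le hy1 (by omega)
        · calc (2 / 3 : ℝ) ^ n * y ^ (m₀ - n) ≤ (2 / 3 : ℝ) ^ n * 1 :=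
                mul_le_mul_of_nonneg_left (pow_le_one₀ hy.le hy1.le) (by positivity)
            _ < 1 := by
              rw [mul_one]
              exact pow_lt_one₀ (by norm_num) (by norm_num) (by omega)
      refine (volume_sublevel_le (d := 3 * y) (by positivity) n
        (F := fun k E => pairingDeriv w k E fun i => (ℓ i : ℝ))
        (fun k x hx => hasDerivAt_pairingDeriv (hw x (hsub x hx)) _ k) hlow hpow).trans ?_
      refine ENNReal.ofReal_le_ofReal ?_
      gcongr
      norm_num
    calc volume s ≤ ∑ k ∈ Finset.range N, volume (J k) :=
          (measure_mono hcover).trans (measure_biUnion_finset_le _ _)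
      _ ≤ ∑ _k ∈ Finset.range N, ENNReal.ofReal (2 ^ m₀ * (3 * y)) :=
          Finset.sum_le_sum fun k _ => hJle k
      _ = ENNReal.ofReal (N * (2 ^ m₀ * (3 * y))) := by
          rw [Finset.sum_const, Finset.card_range, nsmul_eq_mul,
            ENNReal.ofReal_mul (Nat.cast_nonneg N), ENNReal.ofReal_natCast]
      _ ≤ _ := by
          refine ENNReal.ofReal_le_ofReal ?_
          have := mul_pos (sub_pos.2 h12) hy
          nlinarith

/-- The complement is covered by the resonant sets of all `ℓ ≠ 0`, of measure `O((υ
⟨ℓ⟩^{-τ-1})^{1/m₀})`. The extra `⟨ℓ⟩^{-1}`, due to the factor `⟨ℓ⟩` in the non-degeneracy bound,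
makes `(τ + 1) / m₀ > d`, hence the sum finite, even for `τ = m₀ d`. -/
theorem exists_volume_diophantineSet_compl_le {d : ℕ} {w : ℝ → Fin d → ℝ} {E₁ E₂ : ℝ}
    (h12 : E₁ < E₂) (hw : ∀ E ∈ Set.Icc E₁ E₂, ∀ i, AnalyticAt ℝ (fun E => w E i) E) {m₀ : ℕ}
    (hm₀ : 1 ≤ m₀) (hdeg : IsNondegIndex w E₁ E₂ m₀) {τ : ℝ} (hτ : (m₀ : ℝ) * d ≤ τ) :
    ∃ K : ℝ, ∀ υ ∈ Set.Ioo (0 : ℝ) 1,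
      volume.real (Set.Icc E₁ E₂ \ diophantineSet w E₁ E₂ υ τ) ≤ K * υ ^ (1 / (m₀ : ℝ)) := by
  obtain ⟨ρ₀, hρ₀, hdeg⟩ := hdeg
  obtain ⟨K, hK, hvol⟩ := exists_volume_pairing_le h12 hw hm₀ hρ₀ fun E hE ℓ hℓ => by
    obtain ⟨n, hn, hle⟩ := hdeg E hE ℓ hℓ
    exact ⟨n, hn, by rwa [iteratedDerivWithin_pairing hw h12 ℓ n hE] at hle⟩
  have hm0 : (0 : ℝ) < m₀ := by exact_mod_cast hm₀
  have hτ0 : 0 ≤ τ := le_trans (by positivity) hτ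
  set s : ℝ := (τ + 1) / m₀ with hs
  have hds : (d : ℝ) < s := by
    rw [hs, lt_div_iff₀ hm0]
    linarith
  have hs0 : 0 ≤ s := (Nat.cast_nonneg d).trans hds.le
  have hsum := summable_norm_rpow_neg (d := d) hds
  -- Normalised so that `y = Y v ⟨ℓ⟩^{-s}` solves `ρ₀ ⟨ℓ⟩ / 2 * y ^ m₀ = υ ⟨ℓ⟩^{-τ}`.
  set Y : ℝ := (2 / ρ₀) ^ (1 / (m₀ : ℝ)) with hY
  have hY0 : 0 < Y := by positivity
  refine ⟨K * Y * ∑' ℓ : Fin d → ℤ, ‖ℓ‖ ^ (-s), fun υ hυ => ?_⟩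
  have hυ0 := hυ.1
  set v : ℝ := υ ^ (1 / (m₀ : ℝ)) with hv
  have hv0 : 0 < v := by positivity
  set R : (Fin d → ℤ) → Set ℝ := fun ℓ =>
    {E ∈ Set.Icc E₁ E₂ | ℓ ≠ 0 ∧ |pairing (w E) ℓ| ≤ υ * bracket ℓ ^ (-τ)} with hR
  have hcover : Set.Icc E₁ E₂ \ diophantineSet w E₁ E₂ υ τ ⊆ ⋃ ℓ, R ℓ := fun E hE => by
    have h1 : ¬ IsDiophantine υ τ (w E) := fun h => hE.2 ⟨hE.1, h⟩
    unfold IsDiophantine at h1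
    push Not at h1
    obtain ⟨ℓ, hℓ, hlt⟩ := h1
    exact Set.mem_iUnion.2 ⟨ℓ, hE.1, hℓ, hlt.le⟩
  have hRle : ∀ ℓ, volume (R ℓ) ≤ ENNReal.ofReal (K * Y * v * ‖ℓ‖ ^ (-s)) := fun ℓ => by
    by_cases hℓ : ℓ = 0
    · have : R ℓ = ∅ := Set.eq_empty_of_forall_notMem fun E hE => hE.2.1 hℓ
      rw [this, measure_empty]
      exact zero_le
    have hb0 : 0 < bracket ℓ := zero_lt_one.trans_le (one_le_bracket ℓ)
    have hy : 0 < Y * v * bracket ℓ ^ (-s) := by positivity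
    have hpow : (Y * v * bracket ℓ ^ (-s)) ^ m₀ = 2 / ρ₀ * υ * bracket ℓ ^ (-(τ + 1)) := by
      have e1 : Y ^ m₀ = 2 / ρ₀ := by
        rw [hY, one_div, Real.rpow_inv_natCast_pow (by positivity) (by omega)]
      have e2 : v ^ m₀ = υ := by
        rw [hv, one_div, Real.rpow_inv_natCast_pow hυ0.le (by omega)]
      have e3 : (bracket ℓ ^ (-s)) ^ m₀ = bracket ℓ ^ (-(τ + 1)) := by
        rw [← Real.rpow_mul_natCast hb0.le]
        congr 1
        rw [hs]
        field_simp
      rw [mul_pow, mul_pow, e1, e2, e3]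
    have hε : ρ₀ * bracket ℓ / 2 * (Y * v * bracket ℓ ^ (-s)) ^ m₀ = υ * bracket ℓ ^ (-τ) := by
      rw [hpow, neg_add, Real.rpow_add hb0, Real.rpow_neg_one]
      field_simp
    have h1 := hvol ℓ hℓ _ hy
    rw [hε] at h1
    have hsub : R ℓ ⊆ {E ∈ Set.Icc E₁ E₂ | |pairing (w E) ℓ| ≤ υ * bracket ℓ ^ (-τ)} :=
      fun E hE => ⟨hE.1, hE.2.2⟩
    refine (measure_mono hsub).trans (h1.trans (ENNReal.ofReal_le_ofReal ?_))
    calc K * (Y * v * bracket ℓ ^ (-s)) = K * Y * v * bracket ℓ ^ (-s) := by ring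
      _ ≤ _ := mul_le_mul_of_nonneg_left (bracket_rpow_neg_le hℓ hs0) (by positivity)
  have hsum' : Summable fun ℓ : Fin d → ℤ => K * Y * v * ‖ℓ‖ ^ (-s) := hsum.mul_left _
  have htotal : volume (Set.Icc E₁ E₂ \ diophantineSet w E₁ E₂ υ τ) ≤
      ENNReal.ofReal (∑' ℓ : Fin d → ℤ, K * Y * v * ‖ℓ‖ ^ (-s)) := by
    rw [ENNReal.ofReal_tsum_of_nonneg (fun ℓ => by positivity) hsum']
    exact (measure_mono hcover).trans ((measure_iUnion_le _).trans
      (ENNReal.summable.tsum_le_tsum hRle ENNReal.summable))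
  rw [tsum_mul_left] at htotal
  have hfin := ENNReal.toReal_mono ENNReal.ofReal_ne_top htotal
  rw [ENNReal.toReal_ofReal (mul_nonneg (by positivity) (tsum_nonneg fun ℓ => by positivity))]
    at hfin
  refine hfin.trans (le_of_eq ?_)
  ring

theorem isLittleO_volume_diophantineSet_compl {d : ℕ} {w : ℝ → Fin d → ℝ} {E₁ E₂ : ℝ}
    (h12 : E₁ < E₂) (hw : ∀ E ∈ Set.Icc E₁ E₂, ∀ i, AnalyticAt ℝ (fun E => w E i) E) {M m₀ : ℕ}
    (hM : 1 ≤ M) (hMm : M < m₀) (hdeg : IsNondegIndex w E₁ E₂ M) {τ : ℝ}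
    (hτ : (m₀ : ℝ) * d ≤ τ) :
    (fun υ : ℝ => volume.real (Set.Icc E₁ E₂ \ diophantineSet w E₁ E₂ υ τ))
      =o[𝓝[>] 0] fun υ : ℝ => υ ^ (1 / (m₀ : ℝ)) := by
  have hM0 : (0 : ℝ) < M := by exact_mod_cast hM
  have hMm' : (M : ℝ) < m₀ := by exact_mod_cast hMm
  have hτ' : (M : ℝ) * d ≤ τ := le_trans (by gcongr) hτ
  obtain ⟨K, hK⟩ := exists_volume_diophantineSet_compl_le h12 hw hM hdeg hτ'
  have hO : (fun υ : ℝ => volume.real (Set.Icc E₁ E₂ \ diophantineSet w E₁ E₂ υ τ))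
      =O[𝓝[>] 0] fun υ : ℝ => υ ^ (1 / (M : ℝ)) := by
    refine IsBigO.of_bound K ?_
    filter_upwards [Ioo_mem_nhdsGT (zero_lt_one : (0 : ℝ) < 1)] with υ hυ
    rw [Real.norm_of_nonneg measureReal_nonneg, Real.norm_of_nonneg (Real.rpow_nonneg hυ.1.le _)]
    exact hK υ hυ
  refine hO.trans_isLittleO ?_
  have hlt : 1 / (m₀ : ℝ) < 1 / (M : ℝ) := one_div_lt_one_div_of_lt hM0 hMm'
  rw [isLittleO_iff_tendsto' (by
    filter_upwards [self_mem_nhdsWithin] with υ hυ h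
    exact absurd h (Real.rpow_pos_of_pos hυ _).ne')]
  have hlim : Tendsto (fun υ : ℝ => υ ^ (1 / (M : ℝ) - 1 / (m₀ : ℝ))) (𝓝[>] 0) (𝓝 0) := by
    have h := (Real.continuousAt_rpow_const 0 (1 / (M : ℝ) - 1 / (m₀ : ℝ))
      (Or.inr (sub_pos.2 hlt).le)).tendsto
    rw [Real.zero_rpow (sub_pos.2 hlt).ne'] at h
    exact h.mono_left nhdsWithin_le_nhds
  refine hlim.congr' ?_
  filter_upwards [self_mem_nhdsWithin] with υ hυ
  rw [Real.rpow_sub hυ]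

end

end ShearFlow

namespace ShearFlow

/-! ### The frequencies -/

theorem add_one_mul_pi_lt_theta {κ₀ : ℕ} {m S : ℕ} {T : ℝ} {y : Fin κ₀ → ℝ}
    (hθ : κ₀ * Real.pi < theta (wellPotential m S T y) 1 0) {L : ℝ} (hL : 1 < L) (j : Fin κ₀) :
    ((j : ℕ) + 1) * Real.pi < theta (wellPotential m S T y) L 0 := by
  have hj : ((j : ℕ) : ℝ) + 1 ≤ κ₀ := by exact_mod_cast j.2
  exact (mul_le_mul_of_nonneg_right hj Real.pi_pos.le).trans_lt
    (lt_theta_of_le (analyticAt_dilate_wellPotential m S T y) κ₀ hL hθ.le)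

theorem isNthEigenvalue_potential {κ₀ : ℕ} {m S : ℕ} {T : ℝ} {y : Fin κ₀ → ℝ}
    (hθ : κ₀ * Real.pi < theta (wellPotential m S T y) 1 0) {E : ℝ} (hE : wellConst κ₀ < E)
    (j : Fin κ₀) :
    IsNthEigenvalue (potential m S T y E) j ((E / wellConst κ₀) ^ 2 *
      eigBranch (wellPotential m S T y) j (E / wellConst κ₀)) ∧
    eigBranch (wellPotential m S T y) j (E / wellConst κ₀) < 0 := by
  have hW := analyticAt_dilate_wellPotential m S T y
  have hL : 1 < E / wellConst κ₀ := (one_lt_div (wellConst_pos κ₀)).2 hE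
  have hL0 : 0 < E / wellConst κ₀ := zero_lt_one.trans hL
  obtain ⟨h1, h2⟩ := theta_eigBranch hW hL0 (add_one_mul_pi_lt_theta hθ hL j)
  refine ⟨?_, h2⟩
  rw [potential_eq]
  exact isNthEigenvalue_of_theta_eq hW (wellPotential_neg m S T y) hL0 h1

theorem freq_eq_branchFreq {κ₀ : ℕ} {m S : ℕ} {T : ℝ} {y : Fin κ₀ → ℝ}
    (hθ : κ₀ * Real.pi < theta (wellPotential m S T y) 1 0) {E : ℝ} (hE : wellConst κ₀ < E)
    (j : Fin κ₀) :
    freq m S T y E j = branchFreq (wellPotential m S T y) j (E / wellConst κ₀) := by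
  have hL0 : 0 < E / wellConst κ₀ := div_pos ((wellConst_pos κ₀).trans hE) (wellConst_pos κ₀)
  rw [freq, (isNthEigenvalue_potential hθ hE j).1.nthEigenvalue_eq, branchFreq, ← mul_neg,
    Real.sqrt_mul (sq_nonneg _), Real.sqrt_sq hL0.le]

theorem analyticAt_freq {κ₀ : ℕ} {m S : ℕ} {T : ℝ} {y : Fin κ₀ → ℝ}
    (hθ : κ₀ * Real.pi < theta (wellPotential m S T y) 1 0) {E : ℝ} (hE : wellConst κ₀ < E)
    (j : Fin κ₀) : AnalyticAt ℝ (fun E => freq m S T y E j) E := by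
  have hL : 1 < E / wellConst κ₀ := (one_lt_div (wellConst_pos κ₀)).2 hE
  have h1 := analyticAt_branchFreq (analyticAt_dilate_wellPotential m S T y)
    (zero_lt_one.trans hL) (add_one_mul_pi_lt_theta hθ hL j)
  have h2 : AnalyticAt ℝ (fun E => branchFreq (wellPotential m S T y) j (E / wellConst κ₀)) E :=
    AnalyticAt.fun_comp h1 (analyticAt_id.div_const (c := wellConst κ₀))
  refine h2.congr ?_
  filter_upwards [lt_mem_nhds hE] with x hx using (freq_eq_branchFreq hθ hx j).symm

theorem not_eventually_sum_freq_eq_zero {κ₀ : ℕ} {m S : ℕ} {T : ℝ} {y : Fin κ₀ → ℝ}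
    (hθ : κ₀ * Real.pi < theta (wellPotential m S T y) 1 0) {E : ℝ} (hE : wellConst κ₀ < E)
    {c : Fin κ₀ → ℝ} (hc : c ≠ 0) : ¬ ∀ᶠ x in 𝓝 E, ∑ i, freq m S T y x i * c i = 0 := by
  intro h
  have ha := wellConst_pos κ₀
  have hL : 1 < E / wellConst κ₀ := (one_lt_div ha).2 hE
  refine not_eventually_sum_branchFreq_eq_zero (analyticAt_dilate_wellPotential m S T y)
    one_pos hL.le hθ hc ?_
  have htend : Tendsto (fun L => L * wellConst κ₀) (𝓝 (E / wellConst κ₀)) (𝓝 E) := by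
    have : Tendsto (fun L => L * wellConst κ₀) (𝓝 (E / wellConst κ₀))
        (𝓝 (E / wellConst κ₀ * wellConst κ₀)) := Continuous.tendsto (by fun_prop) _
    rwa [div_mul_cancel₀ _ ha.ne'] at this
  filter_upwards [htend.eventually h, htend.eventually (lt_mem_nhds hE)] with L h1 h2
  rw [← h1]
  refine Finset.sum_congr rfl fun i _ => ?_
  rw [freq_eq_branchFreq hθ h2, mul_div_cancel_right₀ _ ha.ne', mul_comm]

end ShearFlow

theorem proposition5p7
    (κ₀ : ℕ) (hκ₀ : 1 ≤ κ₀) (S : ℕ) (hS : 1 ≤ S)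
    (E₁ E₂ : ℝ) (hE₁ : ShearFlow.wellConst κ₀ < E₁) (hE₂ : E₁ < E₂)
    (T : ℝ) (hT : E₂ / ShearFlow.wellConst κ₀ < T)
    (node : ℕ → Fin κ₀ → ℝ)
    (hnode_mem : ∀ m p, node m p ∈ Set.Ioo (0 : ℝ) 1)
    (hnode_lim : ∀ p : Fin κ₀,
      Tendsto (fun m => node m p) atTop (𝓝 (((p : ℝ) + 1) / ((κ₀ : ℝ) + 1 / 4)))) :
    ∃ mbar : ℕ, ∀ m ≥ mbar,
      -- the frequencies are well defined: the first `κ₀` eigenvalues exist and are negative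
      (∀ E ∈ Set.Icc E₁ E₂, ∀ j : Fin κ₀,
        ShearFlow.IsNthEigenvalue (ShearFlow.potential m S T (node m) E) j
          (ShearFlow.nthEigenvalue (ShearFlow.potential m S T (node m) E) j) ∧
        ShearFlow.nthEigenvalue (ShearFlow.potential m S T (node m) E) j < 0) ∧
      -- the set of Diophantine depths is measurable
      (∀ υ ∈ Set.Ioo (0 : ℝ) 1, ∀ τ : ℝ,
        MeasurableSet
          (ShearFlow.diophantineSet (ShearFlow.freq m S T (node m)) E₁ E₂ υ τ)) ∧
      -- every large enough `m₀` is an index of non-degeneracy, and the complement of the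
      -- Diophantine set has measure `o(υ^{1/m₀})`
      (∃ M ≥ 1, ∀ m₀ : ℕ, M ≤ m₀ →
        ShearFlow.IsNondegIndex (ShearFlow.freq m S T (node m)) E₁ E₂ m₀ ∧
        ∀ τ : ℝ, (m₀ : ℝ) * κ₀ ≤ τ →
          (fun υ : ℝ => volume.real (Set.Icc E₁ E₂ \
              ShearFlow.diophantineSet (ShearFlow.freq m S T (node m)) E₁ E₂ υ τ))
            =o[𝓝[>] 0] fun υ : ℝ => υ ^ (1 / (m₀ : ℝ))) ∧
      -- for every index of non-degeneracy `m₀ ≥ 1`, the smallest one included, this measure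
      -- is `O(υ^{1/m₀})`
      (∀ m₀ : ℕ, 1 ≤ m₀ →
        ShearFlow.IsNondegIndex (ShearFlow.freq m S T (node m)) E₁ E₂ m₀ →
        ∀ τ : ℝ, (m₀ : ℝ) * κ₀ ≤ τ →
          ∃ K : ℝ, ∀ υ ∈ Set.Ioo (0 : ℝ) 1,
            volume.real (Set.Icc E₁ E₂ \
              ShearFlow.diophantineSet (ShearFlow.freq m S T (node m)) E₁ E₂ υ τ)
              ≤ K * υ ^ (1 / (m₀ : ℝ))) := by
  have ha := ShearFlow.wellConst_pos κ₀
  have hT1 : 1 ≤ T := (((one_lt_div ha).2 (hE₁.trans hE₂)).trans hT).le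
  obtain ⟨mbar, hmbar⟩ := eventually_atTop.1
    (ShearFlow.eventually_lt_theta_wellPotential hκ₀ S hT1 hnode_lim)
  refine ⟨mbar, fun m hm => ?_⟩
  have hθ := hmbar m hm
  have hlt : ∀ E ∈ Set.Icc E₁ E₂, ShearFlow.wellConst κ₀ < E := fun E hE => hE₁.trans_le hE.1
  have hw : ∀ E ∈ Set.Icc E₁ E₂, ∀ i, AnalyticAt ℝ
      (fun E => ShearFlow.freq m S T (node m) E i) E := fun E hE i =>
    ShearFlow.analyticAt_freq hθ (hlt E hE) i
  obtain ⟨M, hM⟩ := ShearFlow.exists_isNondegIndex hE₂ hw fun E hE c hc =>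
    ShearFlow.not_eventually_sum_freq_eq_zero hθ (hlt E hE) hc
  -- The index `M` may be `0`, while the `o` bound needs an index that is at least `1` and strictly
  -- below `m₀`; `M + 1` is such an index once `m₀ ≥ M + 2`.
  refine ⟨fun E hE j => ?_, fun υ _ τ => ?_, ⟨M + 2, by omega, fun m₀ hm₀ => ⟨?_, fun τ hτ => ?_⟩⟩,
    fun m₀ hm₀ hdeg τ hτ => ?_⟩
  · obtain ⟨h1, h2⟩ := ShearFlow.isNthEigenvalue_potential hθ (hlt E hE) j
    rw [h1.nthEigenvalue_eq]
    have hL0 : 0 < E / ShearFlow.wellConst κ₀ := div_pos (ha.trans (hlt E hE)) ha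
    exact ⟨h1, mul_neg_of_pos_of_neg (by positivity) h2⟩
  · exact ShearFlow.measurableSet_diophantineSet (fun i E hE =>
      (hw E hE i).continuousAt.continuousWithinAt) υ τ
  · exact hM.mono (by omega)
  · exact ShearFlow.isLittleO_volume_diophantineSet_compl hE₂ hw (M := M + 1) (by omega)
      (by omega) (hM.mono (by omega)) hτ
  · exact ShearFlow.exists_volume_diophantineSet_compl_le hE₂ hw hm₀ hdeg hτ
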